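/- **Conventions.** Graphs are finite, simple and undirected; an $n$-vertex graph has vertex set $\{1,\dots,n\}$. Fix $d\in\mathbb N$; a graph is *$d$-bounded* if all its degrees are at most $d$. The *spectrum* $\Lambda_G\in[0,2]^n$ of an $n$-vertex graph $G$ is the sorted vector of eigenvalues (with multiplicity) of its normalized Laplacian $D^{-1/2}(D-A)D^{-1/2}$, where $A$ is the adjacency matrix, $D$ the diagonal degree matrix, and the entry of $D^{-1/2}$ at an isolated vertex is $0$ (so this is $I-D^{-1/2}AD^{-1/2}$ if there are no isolated vertices). A *graph property* is a class of graphs closed under isomorphism; $\Pi_n$ denotes the set of $n$-vertex graphs in $\Pi$. **Robustly spectral properties.** For $\delta>0$, a property $\Pi$ of $d$-bounded graphs is *$\delta$-robustly spectral* if for every $n$ there is a set $S_n$ of spectra of $d$-bounded $n$-vertex graphs such that $\Pi_n$ is the set of all $d$-bounded $n$-vertex graphs $G$ for which there is $x\in S_n$ with $\|\Lambda_G-x\|_1\le\delta n$. **High girth.** An isomorphism-closed class $\mathfrak G$ of graphs has *high girth* if there is $f:\mathbb N\to\mathbb N$ with $f(n)\to\infty$ such that every $n$-vertex graph in $\mathfrak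 G$ has girth at least $f(n)$ (forests have girth $\infty$). **Testing.** A $d$-bounded $n$-vertex graph $G$ is *$\epsilon$-far* from $\Pi$ if more than $\epsilon d n$ edges have to be inserted or deleted to turn $G$ into a $d$-bounded graph in $\Pi_n$ (in particular, if $\Pi_n=\emptyset$). In the bounded-degree graph model an algorithm knows $n$ and accesses the input graph, given by adjacency lists in arbitrary order, through adaptive queries "what is the $i$-th neighbour of $v$?" ($1\le i\le d$), answered by a special symbol if $v$ has fewer than $i$ neighbours. **Theorem.** Let $d\in\mathbb N$, let $\mathfrak G$ be a class of graphs of high girth, let $\delta>0$, and let $\Pi$ be a $\delta$-robustly spectral property of $d$-bounded graphs. Then $\Pi$ is testable in the bounded-degree graph model with degree bound $d$ when the input is restricted to $\mathfrak G$. That is, there is a function $q(\epsilon)$, not depending on $n$, such that for every $\epsilon>0$ and every $n\in\mathbb N$ there is a randomized algorithm which makes at most $q(\epsilon)$ queries and which, for every $d$-bounded $n$-vertex input graph $G\in\mathfrak G$, * accepts with probability at least $2/3$ if $G\in\Pi$, and * rejects with probability at least $2/3$ if $G$ is $\epsilon$-far from $\Pi$. -/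

import Mathlib

noncomputable section

namespace SpectralTesting

open scoped ENNReal

/-- A class of finite graphs closed under isomorphism, i.e. a graph property. The members with
exactly `n` vertices are given as graphs on the vertex set `Fin n`. -/
structure GraphClass where
  graphs : ∀ n : ℕ, Set (SimpleGraph (Fin n))
  iso_closed : ∀ (n : ℕ) (G H : SimpleGraph (Fin n)),
    Nonempty (G ≃g H) → G ∈ graphs n → H ∈ graphs n

/-- The class of all finite graphs. -/
def allGraphs : GraphClass where
  graphs _ := Set.univ
  iso_closed _ _ _ _ _ := Set.mem_univ _

/-- A class has high girth if, for some `f` tending to infinity, each of its `n`-vertex members has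
girth at least `f n`. (`egirth` is the length of a shortest cycle, and `⊤` for forests.) -/
def GraphClass.HighGirth (𝔊 : GraphClass) : Prop :=
  ∃ f : ℕ → ℕ, Filter.Tendsto f Filter.atTop Filter.atTop ∧
    ∀ (n : ℕ) (G : SimpleGraph (Fin n)), G ∈ 𝔊.graphs n → (f n : ℕ∞) ≤ G.egirth

open scoped Classical in
/-- The graph `G` has maximum degree at most `d`. -/
def DegreeBounded {n : ℕ} (d : ℕ) (G : SimpleGraph (Fin n)) : Prop :=
  ∀ v, G.degree v ≤ d

/-! ### Spectra -/

open scoped Classical in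
/-- The normalized Laplacian `D^{-1/2} (D - A) D^{-1/2}`, where the entry of `D^{-1/2}` at an
isolated vertex is `0`. This is `I - D^{-1/2} A D^{-1/2}` when there are no isolated vertices; the
row and column of an isolated vertex are zero, so that the multiplicity of the eigenvalue `0` is
always the number of connected components. -/
def normLaplacian {n : ℕ} (G : SimpleGraph (Fin n)) : Matrix (Fin n) (Fin n) ℝ :=
  Matrix.diagonal (fun v => (√(G.degree v : ℝ))⁻¹) * G.lapMatrix ℝ *
    Matrix.diagonal (fun v => (√(G.degree v : ℝ))⁻¹)

theorem normLaplacian_isHermitian {n : ℕ} (G : SimpleGraph (Fin n)) :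
    (normLaplacian G).IsHermitian := by
  classical
  unfold normLaplacian
  rw [Matrix.IsHermitian, Matrix.conjTranspose_mul, Matrix.conjTranspose_mul,
    Matrix.diagonal_conjTranspose, Matrix.conjTranspose_eq_transpose_of_trivial (G.lapMatrix ℝ),
    (G.isSymm_lapMatrix (R := ℝ)).eq, Matrix.mul_assoc]
  rfl

/-- The spectrum of `G`: the eigenvalues of its normalized Laplacian with multiplicity, sorted in
decreasing order. -/
def graphSpectrum {n : ℕ} (G : SimpleGraph (Fin n)) : Fin n → ℝ := fun i =>
  (normLaplacian_isHermitian G).eigenvalues₀ (Fin.cast (Fintype.card_fin n).symm i)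

/-- The spectra realized by the `d`-bounded degree graphs with `n` vertices in the class `𝔎`. -/
def realizedSpectra (d : ℕ) (𝔎 : GraphClass) (n : ℕ) : Set (Fin n → ℝ) :=
  {x | ∃ G ∈ 𝔎.graphs n, DegreeBounded d G ∧ graphSpectrum G = x}

/-- `P` is `δ`-robustly spectral with respect to the class `𝔎` (and the degree bound `d`): for each
`n` there is a set `S` of spectra realized in `𝔎` such that the `n`-vertex members of `P` are
the `d`-bounded degree graphs in `𝔎` whose spectrum has `ℓ₁`-distance at most `δ n` to `S`. -/
def RobustlySpectral (d : ℕ) (𝔎 : GraphClass) (δ : ℝ) (P : GraphClass) : Prop :=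
  ∀ n : ℕ, ∃ S ⊆ realizedSpectra d 𝔎 n, ∀ G : SimpleGraph (Fin n),
    G ∈ P.graphs n ↔
      G ∈ 𝔎.graphs n ∧ DegreeBounded d G ∧ ∃ x ∈ S, ∑ i, |graphSpectrum G i - x i| ≤ δ * n

/-! ### The bounded degree graph model -/

/-- `G` is `ε`-far from `P`: every `d`-bounded degree graph on the same vertices with property `P`
differs from `G` in more than `ε d n` edges. -/
def IsFar {n : ℕ} (d : ℕ) (ε : ℝ) (P : GraphClass) (G : SimpleGraph (Fin n)) : Prop :=
  ∀ H : SimpleGraph (Fin n), DegreeBounded d H → H ∈ P.graphs n →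
    ε * d * n < ((symmDiff G.edgeSet H.edgeSet).ncard : ℝ)

/-- An answering function for the queries "what is the `i`-th neighbour of `v`?"; the value `none`
means that there is no such neighbour. -/
abbrev Oracle (n d : ℕ) : Type := Fin n → Fin d → Option (Fin n)

open scoped Classical in
/-- `O` represents `G` by adjacency lists: `O v` lists the neighbours of `v`, each once and in an
arbitrary order, in its first `deg v` places, followed by `none`. -/
structure Oracle.Represents {n d : ℕ} (O : Oracle n d) (G : SimpleGraph (Fin n)) : Prop where
  adj : ∀ v i w, O v i = some w → G.Adj v w
  inj : ∀ v i j w, O v i = some w → O v j = some w → i = j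
  isSome_iff : ∀ v i, (O v i).isSome ↔ (i : ℕ) < G.degree v

/-- A deterministic adaptive query algorithm: it either stops with an answer (`true` = accept,
`false` = reject) or asks for the `i`-th neighbour of `v` and continues depending on the reply. -/
inductive QueryTree (n d : ℕ) : Type
  | answer (b : Bool) : QueryTree n d
  | query (v : Fin n) (i : Fin d) (next : Option (Fin n) → QueryTree n d) : QueryTree n d

/-- The answer of the algorithm when its queries are answered by `O`. -/
def QueryTree.run {n d : ℕ} (O : Oracle n d) : QueryTree n d → Bool
  | .answer b => b
  | .query v i next => (next (O v i)).run O

/-- The number of queries that the algorithm makes when they are answered by `O`. -/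
def QueryTree.numQueries {n d : ℕ} (O : Oracle n d) : QueryTree n d → ℕ
  | .answer _ => 0
  | .query v i next => (next (O v i)).numQueries O + 1

/-- A randomized query algorithm: a probability distribution over deterministic ones. -/
abbrev RandomizedAlgorithm (n d : ℕ) : Type := PMF (QueryTree n d)

/-- The probability that the algorithm outputs `b` when its queries are answered by `O`. -/
def RandomizedAlgorithm.prob {n d : ℕ} (A : RandomizedAlgorithm n d) (O : Oracle n d) (b : Bool) :
    ℝ≥0∞ :=
  (PMF.map (QueryTree.run O) A) b

/-- The property `P` is testable in the bounded degree graph model with degree bound `d` when the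
input is restricted to the class `𝔊`: the number of queries is bounded independently of `n`. -/
def TestableOn (d : ℕ) (𝔊 P : GraphClass) : Prop :=
  ∃ q : ℝ → ℕ, ∀ ε : ℝ, 0 < ε → ∀ n : ℕ, ∃ A : RandomizedAlgorithm n d,
    (∀ T ∈ A.support, ∀ O : Oracle n d, T.numQueries O ≤ q ε) ∧
    ∀ G ∈ 𝔊.graphs n, DegreeBounded d G → ∀ O : Oracle n d, O.Represents G →
      (G ∈ P.graphs n → 2 / 3 ≤ A.prob O true) ∧
      (IsFar d ε P G → 2 / 3 ≤ A.prob O false)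

end SpectralTesting

end

/-
The normalized traces of polynomials of the normalized Laplacian, the moments of a graph, determine
the spectrum up to a small `ℓ₁`-error once finitely many of them are known. If the girth exceeds the
degree of the polynomial, then its trace is a sum of contributions of the vertices which depend only
on the local structure given by colour refinement. Hence sampling a bounded number of vertices
estimates finitely many moments of `G`, and the tester accepts if the estimate is close to the
moments of some member of the property.

This is sound because a graph `G` whose moments are close to those of a member is close to the
property: the spectrum of `G` has distance at most `(δ + γ) n` from one of the prescribed spectra,
that of `X` say, for a small `γ`. Edit `G` on a small proportion `ρ` of its vertices, replacing the
graph there by disjoint copies of a small graph whose moments approximate those of `X`. The edited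
graph has moments close to `1 - ρ` times those of `G` plus `ρ` times those of `X`, so that its
spectrum is closer to that of `X` by the factor `1 - ρ`, which makes up for `γ`. For this, the
removed vertices have to contain the right proportion of each colour and to span few edges to the
other vertices. Swapping pairs of distant edges with matching colours preserves all colours and the
girth condition, and a set to which no swap applies has a boundary of bounded size.
-/

noncomputable section

namespace SpectralTesting

open scoped Classical BigOperators
open Finset Polynomial

/-! ### Colour refinement -/

section Color

variable {V W : Type*} [Fintype V] [Fintype W] {G : SimpleGraph V} {H : SimpleGraph W}
  {i j d : ℕ} {v : V} {w : W}

/-- Colour refinement: `color G j v` encodes the isomorphism type of the ball of radius `j` around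
a lift of `v` to the universal cover of `G`. Two vertices, possibly of different graphs, have the
same colour at level `j + 1` when their neighbours have the same multiset of colours at level
`j`. -/
def color (G : SimpleGraph V) : ℕ → V → ℕ
  | 0, _ => 0
  | j + 1, v => Encodable.encode ((G.neighborFinset v).val.map (color G j))

theorem color_succ_eq_color_succ_iff :
    color G (j + 1) v = color H (j + 1) w ↔
      (G.neighborFinset v).val.map (color G j) = (H.neighborFinset w).val.map (color H j) := by
  simp only [color, Encodable.encode_inj]

theorem multiset_map_eq_map_of_map_eq_map {α β γ ε : Type*} {s : Multiset α} {t : Multiset β}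
    {f : α → γ} {g : β → γ} {f' : α → ε} {g' : β → ε} (h : s.map f = t.map g)
    (hf : ∀ x ∈ s, ∀ y ∈ t, f x = g y → f' x = g' y) : s.map f' = t.map g' := by
  rw [← Multiset.rel_eq, Multiset.rel_map] at h ⊢
  exact h.mono hf

theorem color_eq_color_of_succ :
    ∀ {v : V} {w : W}, color G (j + 1) v = color H (j + 1) w → color G j v = color H j w := by
  induction j with
  | zero => exact fun _ => rfl
  | succ j ih =>
    intro v w h
    rw [color_succ_eq_color_succ_iff] at h ⊢
    exact multiset_map_eq_map_of_map_eq_map h fun x _ y _ => ih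

theorem color_eq_color_of_le (hij : i ≤ j) (h : color G j v = color H j w) :
    color G i v = color H i w := by
  induction j, hij using Nat.le_induction with
  | base => exact h
  | succ j _ ih => exact ih (color_eq_color_of_succ h)

theorem degree_eq_degree_of_color_eq (h : color G (j + 1) v = color H (j + 1) w) :
    G.degree v = H.degree w := by
  rw [color_succ_eq_color_succ_iff] at h
  simpa using congrArg Multiset.card h

theorem sum_neighborFinset_eq_of_color_eq {M : Type*} [AddCommMonoid M]
    (h : color G (j + 1) v = color H (j + 1) w) {f : V → M} {g : W → M}
    (hfg : ∀ x ∈ G.neighborFinset v, ∀ y ∈ H.neighborFinset w,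
      color G j x = color H j y → f x = g y) :
    ∑ x ∈ G.neighborFinset v, f x = ∑ y ∈ H.neighborFinset w, g y :=
  congrArg Multiset.sum
    (multiset_map_eq_map_of_map_eq_map (color_succ_eq_color_succ_iff.1 h) hfg)

theorem sum_neighborFinset_erase_eq_of_color_eq {M : Type*} [AddCommMonoid M]
    [DecidableEq V] [DecidableEq W] (h : color G (j + 1) v = color H (j + 1) w) {a : V} {b : W}
    (ha : G.Adj v a) (hb : H.Adj w b) (hab : color G j a = color H j b) {f : V → M} {g : W → M}
    (hfg : ∀ x ∈ (G.neighborFinset v).erase a, ∀ y ∈ (H.neighborFinset w).erase b,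
      color G j x = color H j y → f x = g y) :
    ∑ x ∈ (G.neighborFinset v).erase a, f x = ∑ y ∈ (H.neighborFinset w).erase b, g y := by
  have hmap : ((G.neighborFinset v).erase a).val.map (color G j) =
      ((H.neighborFinset w).erase b).val.map (color H j) := by
    rw [erase_val, erase_val, Multiset.map_erase_of_mem _ _ (by simpa using ha),
      Multiset.map_erase_of_mem _ _ (by simpa using hb), color_succ_eq_color_succ_iff.1 h, hab]
  exact congrArg Multiset.sum (multiset_map_eq_map_of_map_eq_map hmap hfg)

theorem finite_setOf_multiset_card_le {α : Type*} {s : Set α} (hs : s.Finite) (d : ℕ) :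
    {m : Multiset α | m.card ≤ d ∧ ∀ x ∈ m, x ∈ s}.Finite := by
  refine (Set.finite_Iic (d • hs.toFinset.val)).subset fun m hm => Multiset.le_iff_count.2 ?_
  intro a
  by_cases ha : a ∈ m
  · rw [Multiset.count_nsmul,
      Multiset.count_eq_one_of_mem hs.toFinset.nodup (by simpa using hm.2 a ha)]
    simpa using (Multiset.count_le_card a m).trans hm.1
  · simp [ha]

theorem exists_finset_forall_color_mem (d j : ℕ) : ∃ K : Finset ℕ,
    ∀ (V : Type*) [Fintype V] (G : SimpleGraph V), (∀ v, G.degree v ≤ d) →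
      ∀ v, color G j v ∈ K := by
  induction j with
  | zero => exact ⟨{0}, by simp [color]⟩
  | succ j ih =>
    obtain ⟨K, hK⟩ := ih
    refine ⟨((finite_setOf_multiset_card_le K.finite_toSet d).image Encodable.encode).toFinset,
      fun V _ G hG v => (Set.Finite.mem_toFinset _).2 ⟨_, ⟨by simpa using hG v, ?_⟩, rfl⟩⟩
    simpa using fun w _ => hK V G hG w

end Color

/-! ### The normalized Laplacian and colours -/

section Walk

variable {V W : Type*} {G : SimpleGraph V} {H : SimpleGraph W} {x v z : V} {y w : W}

theorem isPath_cons_of_length_lt_egirth {p : G.Walk x v} (hp : p.IsPath) (h : G.Adj z x)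
    (hz : z ≠ p.snd) (hg : ((p.length + 1 : ℕ) : ℕ∞) < G.egirth) : (p.cons h).IsPath := by
  refine (SimpleGraph.Walk.cons_isPath_iff h p).2 ⟨hp, fun hzp => ?_⟩
  have hcycle : ((p.takeUntil z hzp).cons h).IsCycle := by
    refine (SimpleGraph.Walk.cons_isCycle_iff _ h).2 ⟨hp.takeUntil hzp, fun he => hz ?_⟩
    exact hp.eq_snd_of_mem_edges (Sym2.eq_swap ▸ p.edges_takeUntil_subset_edges hzp he)
  refine (hg.trans_le (SimpleGraph.egirth_le_length hcycle)).not_ge ?_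
  exact_mod_cast Nat.succ_le_succ (p.length_takeUntil_le_length hzp)

theorem length_tail_le (p : G.Walk x v) : p.tail.length ≤ p.length := by
  cases p <;> simp

theorem forall₂_support_tail {p : G.Walk x v} {q : H.Walk y w} {R : V → W → Prop}
    (h : List.Forall₂ R p.support q.support) :
    List.Forall₂ R p.tail.support q.tail.support := by
  cases p with
  | nil => cases q with
    | nil => exact h
    | cons => simpa using h.length_eq
  | cons _ p => cases q with
    | nil => simpa using h.length_eq
    | cons _ q => simpa using (List.forall₂_cons.1 h).2

variable [Fintype V] [Fintype W]

theorem sum_eq_add_sum_neighborFinset {f : V → ℝ}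
    (hf : ∀ y, x ≠ y → ¬G.Adj x y → f y = 0) :
    ∑ y, f y = f x + ∑ y ∈ G.neighborFinset x, f y := by
  rw [← sum_insert (by simp)]
  refine (sum_subset (subset_univ _) fun y _ hy => ?_).symm
  rw [mem_insert, SimpleGraph.mem_neighborFinset, not_or] at hy
  exact hf y (Ne.symm hy.1) hy.2

theorem sum_neighborFinset_eq_of_support_color_eq {M : Type*} [AddCommMonoid M] {j : ℕ}
    {p : G.Walk x v} {q : H.Walk y w}
    (hcol : List.Forall₂ (fun a b => color G (j + 1) a = color H (j + 1) b) p.support q.support)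
    {f : V → M} {g : W → M} (hsnd : f p.snd = g q.snd)
    (hfg : ∀ a b, G.Adj x a → H.Adj y b → a ≠ p.snd → b ≠ q.snd → color G j a = color H j b →
      f a = g b) :
    ∑ a ∈ G.neighborFinset x, f a = ∑ b ∈ H.neighborFinset y, g b := by
  cases p with
  | nil => cases q with
    | nil =>
      obtain ⟨hxy, -⟩ := List.forall₂_cons.1 hcol
      refine sum_neighborFinset_eq_of_color_eq hxy fun a ha b hb => ?_
      rw [SimpleGraph.mem_neighborFinset] at ha hb
      exact hfg a b ha hb ha.ne' hb.ne'
    | cons => simpa using hcol.length_eq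
  | @cons _ c _ hc p => cases q with
    | nil => simpa using hcol.length_eq
    | @cons _ e _ he q =>
      simp only [SimpleGraph.Walk.snd_cons] at hsnd hfg
      obtain ⟨hxy, hcol'⟩ := List.forall₂_cons.1 hcol
      have hce : color G (j + 1) c = color H (j + 1) e := by
        rw [← p.cons_tail_support, ← q.cons_tail_support] at hcol'
        exact (List.forall₂_cons.1 hcol').1
      rw [← add_sum_erase _ _ ((G.mem_neighborFinset x c).2 hc),
        ← add_sum_erase _ _ ((H.mem_neighborFinset y e).2 he)]
      refine congrArg₂ (· + ·) hsnd (sum_neighborFinset_erase_eq_of_color_eq hxy hc he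
        (color_eq_color_of_succ hce) fun a ha b hb => ?_)
      rw [mem_erase, SimpleGraph.mem_neighborFinset] at ha hb
      exact hfg a b ha.2 hb.2 ha.1 hb.1

end Walk

section NormalizedLaplacian

variable {V W : Type*} [Fintype V] [Fintype W] [DecidableEq V] [DecidableEq W]
  {G : SimpleGraph V} {H : SimpleGraph W} {d m : ℕ}

/-- The normalized Laplacian of a graph on an arbitrary finite vertex type, given entrywise. -/
def normalizedLaplacian (G : SimpleGraph V) : Matrix V V ℝ := fun x y =>
  if x = y then (if G.degree x = 0 then 0 else 1)
  else if G.Adj x y then -((√(G.degree x : ℝ))⁻¹ * (√(G.degree y : ℝ))⁻¹) else 0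

theorem normLaplacian_eq_normalizedLaplacian {n : ℕ} (G : SimpleGraph (Fin n)) :
    normLaplacian G = normalizedLaplacian G := by
  ext x y
  simp only [normLaplacian, normalizedLaplacian, Matrix.mul_diagonal, Matrix.diagonal_mul,
    SimpleGraph.lapMatrix, Matrix.sub_apply, SimpleGraph.degMatrix, Matrix.diagonal_apply,
    SimpleGraph.adjMatrix_apply]
  rcases eq_or_ne x y with rfl | hxy
  · rcases Nat.eq_zero_or_pos (G.degree x) with h0 | h0
    · simp [h0]
    · have hpos : (0 : ℝ) < G.degree x := by exact_mod_cast h0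
      have hsqrt : √(G.degree x : ℝ) ≠ 0 := (Real.sqrt_pos.2 hpos).ne'
      simp only [if_true, SimpleGraph.irrefl, if_false, sub_zero, h0.ne']
      field_simp
      rw [Real.sq_sqrt hpos.le]
  · by_cases ha : G.Adj x y <;> simp [hxy, ha]

theorem normalizedLaplacian_eq_zero {x y : V} (hne : x ≠ y) (hadj : ¬G.Adj x y) :
    normalizedLaplacian G x y = 0 := by
  simp [normalizedLaplacian, hne, hadj]

theorem abs_normalizedLaplacian_le_one (G : SimpleGraph V) (x y : V) :
    |normalizedLaplacian G x y| ≤ 1 := by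
  have inv_sqrt_le_one (z : V) : (√(G.degree z : ℝ))⁻¹ ≤ 1 := by
    rcases Nat.eq_zero_or_pos (G.degree z) with h | h
    · simp [h]
    · exact inv_le_one_of_one_le₀ (Real.one_le_sqrt.2 (by exact_mod_cast h))
  unfold normalizedLaplacian
  split_ifs
  · simp
  · simp
  · rw [abs_neg, abs_of_nonneg (by positivity)]
    exact mul_le_one₀ (inv_sqrt_le_one x) (by positivity) (inv_sqrt_le_one y)
  · simp

theorem normalizedLaplacian_pow_succ_apply (G : SimpleGraph V) (m : ℕ) (x v : V) :
    (normalizedLaplacian G ^ (m + 1)) x v =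
      normalizedLaplacian G x x * (normalizedLaplacian G ^ m) x v +
        ∑ y ∈ G.neighborFinset x, normalizedLaplacian G x y * (normalizedLaplacian G ^ m) y v := by
  rw [pow_succ', Matrix.mul_apply]
  exact sum_eq_add_sum_neighborFinset fun y hne hadj => by
    rw [normalizedLaplacian_eq_zero hne hadj, zero_mul]

theorem normalizedLaplacian_self_eq_of_degree_eq {v : V} {w : W} (h : G.degree v = H.degree w) :
    normalizedLaplacian G v v = normalizedLaplacian H w w := by
  simp [normalizedLaplacian, h]

theorem normalizedLaplacian_eq_of_degree_eq {v x : V} {w y : W} (hvx : G.Adj v x)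
    (hwy : H.Adj w y) (h : G.degree v = H.degree w) (h' : G.degree x = H.degree y) :
    normalizedLaplacian G v x = normalizedLaplacian H w y := by
  simp [normalizedLaplacian, hvx, hwy, hvx.ne, hwy.ne, h, h']

theorem normalizedLaplacian_snd_eq_of_support_color_eq {x v : V} {y w : W} {p : G.Walk x v}
    {q : H.Walk y w}
    (h : List.Forall₂ (fun a b => color G (m + 1) a = color H (m + 1) b) p.support q.support) :
    normalizedLaplacian G x p.snd = normalizedLaplacian H y q.snd := by
  cases p with
  | nil => cases q with
    | nil =>
      exact normalizedLaplacian_self_eq_of_degree_eq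
        (degree_eq_degree_of_color_eq (List.forall₂_cons.1 h).1)
    | cons => simpa using h.length_eq
  | cons hc p => cases q with
    | nil => simpa using h.length_eq
    | cons he q =>
      rw [SimpleGraph.Walk.snd_cons, SimpleGraph.Walk.snd_cons]
      obtain ⟨hxy, htail⟩ := List.forall₂_cons.1 h
      rw [← p.cons_tail_support, ← q.cons_tail_support] at htail
      exact normalizedLaplacian_eq_of_degree_eq hc he (degree_eq_degree_of_color_eq hxy)
        (degree_eq_degree_of_color_eq (List.forall₂_cons.1 htail).1)

theorem one_apply_eq_of_isPath {V W : Type*} [DecidableEq V] [DecidableEq W]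
    {G : SimpleGraph V} {H : SimpleGraph W} {x v : V} {y w : W} (p : G.Walk x v)
    (q : H.Walk y w) (hp : p.IsPath) (hq : q.IsPath) (hlen : p.length = q.length) :
    (1 : Matrix V V ℝ) x v = (1 : Matrix W W ℝ) y w := by
  have hiff : x = v ↔ y = w := by
    constructor
    · rintro rfl
      have hp0 := SimpleGraph.Walk.length_eq_zero_iff.2 (SimpleGraph.Walk.isPath_iff_nil.1 hp)
      exact SimpleGraph.Walk.eq_of_length_eq_zero (hlen.symm.trans hp0)
    · rintro rfl
      have hq0 := SimpleGraph.Walk.length_eq_zero_iff.2 (SimpleGraph.Walk.isPath_iff_nil.1 hq)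
      exact SimpleGraph.Walk.eq_of_length_eq_zero (hlen.trans hq0)
  simp only [Matrix.one_apply, hiff]

-- A walk from `x` to `v` is read along a path `p` from `x` to `v`: its first step either goes back
-- along `p` or, because of the girth, makes `p` a longer path. The neighbours of the second kind
-- are matched by colour.
theorem normalizedLaplacian_pow_apply_eq_of_isPath {x v : V} {y w : W} (p : G.Walk x v)
    (q : H.Walk y w) (hp : p.IsPath) (hq : q.IsPath)
    (hcol : List.Forall₂ (fun a b => color G (m + 1) a = color H (m + 1) b) p.support q.support)
    (hG : ((p.length + m : ℕ) : ℕ∞) < G.egirth) (hH : ((q.length + m : ℕ) : ℕ∞) < H.egirth) :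
    (normalizedLaplacian G ^ m) x v = (normalizedLaplacian H ^ m) y w := by
  induction m generalizing x y with
  | zero =>
    simp only [pow_zero]
    exact one_apply_eq_of_isPath p q hp hq (by simpa using hcol.length_eq)
  | succ m ih =>
    have lt_of_le {i j : ℕ} {g : ℕ∞} (hj : (j : ℕ∞) < g) (hij : i ≤ j) : (i : ℕ∞) < g :=
      lt_of_le_of_lt (by exact_mod_cast hij) hj
    have hcol' := hcol.imp fun a b => color_eq_color_of_succ
    have hdeg : G.degree x = H.degree y := by
      rw [← p.cons_tail_support, ← q.cons_tail_support] at hcol'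
      exact degree_eq_degree_of_color_eq (List.forall₂_cons.1 hcol').1
    rw [normalizedLaplacian_pow_succ_apply, normalizedLaplacian_pow_succ_apply,
      normalizedLaplacian_self_eq_of_degree_eq hdeg,
      ih p q hp hq hcol' (lt_of_le hG (by lia)) (lt_of_le hH (by lia))]
    congr 1
    refine sum_neighborFinset_eq_of_support_color_eq hcol ?_ fun a b ha hb hap hbq hab => ?_
    · rw [normalizedLaplacian_snd_eq_of_support_color_eq hcol',
        ih p.tail q.tail hp.tail hq.tail (forall₂_support_tail hcol') (lt_of_le hG ?_)
          (lt_of_le hH ?_)] <;>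
      · refine (add_le_add_left (length_tail_le _) m).trans ?_
        lia
    · rw [normalizedLaplacian_eq_of_degree_eq ha hb hdeg (degree_eq_degree_of_color_eq hab)]
      congr 1
      refine ih (p.cons ha.symm) (q.cons hb.symm)
        (isPath_cons_of_length_lt_egirth hp ha.symm hap (lt_of_le hG (by lia)))
        (isPath_cons_of_length_lt_egirth hq hb.symm hbq (lt_of_le hH (by lia)))
        (.cons hab hcol') (lt_of_le hG ?_) (lt_of_le hH ?_) <;>
      · rw [SimpleGraph.Walk.length_cons]
        lia

theorem normalizedLaplacian_pow_apply_self_eq_of_color_eq {v : V} {w : W}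
    (hG : (m : ℕ∞) < G.egirth) (hH : (m : ℕ∞) < H.egirth)
    (h : color G (m + 1) v = color H (m + 1) w) :
    (normalizedLaplacian G ^ m) v v = (normalizedLaplacian H ^ m) w w :=
  normalizedLaplacian_pow_apply_eq_of_isPath .nil .nil .nil .nil
    (by simpa using h)
    (by simpa using hG) (by simpa using hH)

end NormalizedLaplacian

/-! ### The distance of sorted sequences -/

section SortedDistance

/-- The function equal to `h` up to `a`, decreasing with slope `-1` on `[a, a + h]`, and equal to
`0` from there on. Sums of its values replace the counting of eigenvalues below `a`, which is not
continuous. -/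
def ramp (a h x : ℝ) : ℝ := max 0 (min h (a + h - x))

theorem ramp_mem_Icc {h : ℝ} (hh : 0 ≤ h) (a x : ℝ) : ramp a h x ∈ Set.Icc 0 h :=
  ⟨le_max_left _ _, max_le hh (min_le_left _ _)⟩

theorem antitone_ramp (a h : ℝ) : Antitone (ramp a h) := by
  intro x y hxy
  unfold ramp
  gcongr

theorem continuous_ramp (a h : ℝ) : Continuous (ramp a h) := by
  unfold ramp
  fun_prop

theorem mem_Ioo_of_ramp_mem_Ioo {a h x : ℝ} (hx : ramp a h x ∈ Set.Ioo 0 h) :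
    x ∈ Set.Ioo a (a + h) := by
  simp only [ramp, Set.mem_Ioo, lt_max_iff, max_lt_iff, lt_min_iff, min_lt_iff, lt_irrefl,
    false_or] at hx
  constructor <;> linarith

theorem sum_ramp (a : ℝ) {h : ℝ} (hh : 0 ≤ h) (x : ℝ) (N : ℕ) :
    ∑ l ∈ range N, ramp (a + l * h) h x = max 0 (min (N * h) (a + N * h - x)) := by
  induction N with
  | zero => simp
  | succ N ih =>
    have hN : 0 ≤ N * h := by positivity
    rw [sum_range_succ, ih, ramp]
    push_cast
    rcases le_total (a + N * h - x) 0 with h1 | h1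
    · rw [max_eq_left ((min_le_right _ _).trans h1), min_eq_right (a := h) (by linarith),
        min_eq_right (a := ((N : ℝ) + 1) * h) (by linarith), zero_add]
      ring_nf
    · rw [min_eq_left (a := h) (by linarith), max_eq_right (le_min hN h1), max_eq_right hh,
        max_eq_right (le_min (by linarith) (by linarith)), ← min_add_add_right]
      ring_nf

theorem sum_abs_ramp_sub_ramp {a h x y : ℝ} (hh : 0 ≤ h) {N : ℕ}
    (hx : x ∈ Set.Icc a (a + N * h)) (hy : y ∈ Set.Icc a (a + N * h)) :
    ∑ l ∈ range N, |ramp (a + l * h) h x - ramp (a + l * h) h y| = |x - y| := by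
  wlog hxy : x ≤ y generalizing x y
  · rw [abs_sub_comm x y, ← this hy hx (le_of_not_ge hxy)]
    exact sum_congr rfl fun l _ => abs_sub_comm _ _
  have sum_ramp_eq {z : ℝ} (hz : z ∈ Set.Icc a (a + N * h)) :
      ∑ l ∈ range N, ramp (a + l * h) h z = a + N * h - z := by
    rw [sum_ramp a hh, min_eq_right (by linarith [hz.1]), max_eq_right (by linarith [hz.2])]
  rw [sum_congr rfl fun l _ => abs_of_nonneg (sub_nonneg.2 (antitone_ramp _ _ hxy)),
    sum_sub_distrib, sum_ramp_eq hx, sum_ramp_eq hy, abs_of_nonpos (by linarith)]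
  ring

theorem card_ramp_mem_Ioo_le_one {h : ℝ} (hh : 0 ≤ h) (a x : ℝ) (N : ℕ) :
    #{l ∈ range N | ramp (a + (l : ℕ) * h) h x ∈ Set.Ioo 0 h} ≤ 1 := by
  have not_both {l l' : ℕ} (hl : ramp (a + l * h) h x ∈ Set.Ioo 0 h)
      (hl' : ramp (a + l' * h) h x ∈ Set.Ioo 0 h) : ¬l < l' := fun hlt => by
    have hle : (l : ℝ) + 1 ≤ l' := by exact_mod_cast hlt
    nlinarith [(mem_Ioo_of_ramp_mem_Ioo hl).2, (mem_Ioo_of_ramp_mem_Ioo hl').1]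
  refine card_le_one.2 fun l hl l' hl' => ?_
  have hl := (mem_filter.1 hl).2
  have hl' := (mem_filter.1 hl').2
  exact le_antisymm (not_lt.1 (not_both hl' hl)) (not_lt.1 (not_both hl hl'))

theorem abs_sub_le_sub_add_of_mem_Icc {a b h : ℝ} (ha : a ∈ Set.Icc 0 h) (hb : b ∈ Set.Icc 0 h)
    (hab : ¬(a = 0 ∧ b = h)) :
    |a - b| ≤ a - b + 2 * h *
      ((if a ∈ Set.Ioo 0 h then 1 else 0) + (if b ∈ Set.Ioo 0 h then 1 else 0)) := by
  obtain ⟨ha0, hah⟩ := ha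
  obtain ⟨hb0, hbh⟩ := hb
  have hh : 0 ≤ h := ha0.trans hah
  by_cases hba : b ≤ a
  · rw [abs_of_nonneg (sub_nonneg.2 hba)]
    exact le_add_of_nonneg_right (by positivity)
  · have hmem : a ∈ Set.Ioo 0 h ∨ b ∈ Set.Ioo 0 h := by
      rcases ha0.eq_or_lt with ha0 | ha0
      · exact .inr ⟨by linarith, hbh.lt_of_ne fun hb => hab ⟨ha0.symm, hb⟩⟩
      · exact .inl ⟨ha0, by linarith⟩
    rw [abs_of_neg (by linarith)]
    split_ifs <;> first | linarith | tauto

section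

variable {ι : Type*} [Fintype ι] {h : ℝ} {a b : ι → ℝ}

theorem sum_abs_sub_le_of_forall_not (ha : ∀ i, a i ∈ Set.Icc 0 h) (hb : ∀ i, b i ∈ Set.Icc 0 h)
    (hab : ∀ i, ¬(a i = 0 ∧ b i = h)) :
    ∑ i, |a i - b i| ≤ |∑ i, a i - ∑ i, b i| +
      2 * h * (#{i | a i ∈ Set.Ioo 0 h} + #{i | b i ∈ Set.Ioo 0 h}) := by
  calc ∑ i, |a i - b i|
      ≤ ∑ i, (a i - b i + 2 * h *
          ((if a i ∈ Set.Ioo 0 h then 1 else 0) + (if b i ∈ Set.Ioo 0 h then 1 else 0))) :=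
        sum_le_sum fun i _ => abs_sub_le_sub_add_of_mem_Icc (ha i) (hb i) (hab i)
    _ = (∑ i, a i - ∑ i, b i) +
          2 * h * (#{i | a i ∈ Set.Ioo 0 h} + #{i | b i ∈ Set.Ioo 0 h}) := by
        rw [sum_add_distrib, sum_sub_distrib, ← mul_sum, sum_add_distrib, sum_boole, sum_boole]
    _ ≤ _ := by
        gcongr
        exact le_abs_self _

theorem sum_abs_sub_le_of_monotone [LinearOrder ι] (hh : 0 < h) (ha : Monotone a)
    (hb : Monotone b) (ha' : ∀ i, a i ∈ Set.Icc 0 h) (hb' : ∀ i, b i ∈ Set.Icc 0 h) :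
    ∑ i, |a i - b i| ≤ |∑ i, a i - ∑ i, b i| +
      2 * h * (#{i | a i ∈ Set.Ioo 0 h} + #{i | b i ∈ Set.Ioo 0 h}) := by
  by_cases hab : ∀ i, ¬(a i = 0 ∧ b i = h)
  · exact sum_abs_sub_le_of_forall_not ha' hb' hab
  · push Not at hab
    obtain ⟨j, haj, hbj⟩ := hab
    have hba : ∀ i, ¬(b i = 0 ∧ a i = h) := by
      rintro i ⟨hbi, hai⟩
      rcases le_total i j with hij | hij
      · linarith [ha hij]
      · linarith [hb hij]
    simpa only [abs_sub_comm, add_comm (#{i | b i ∈ Set.Ioo 0 h} : ℝ)] using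
      sum_abs_sub_le_of_forall_not hb' ha' hba

end

theorem sum_card_ramp_mem_Ioo_le {h : ℝ} (hh : 0 ≤ h) (a : ℝ) (N : ℕ) {ι : Type*} [Fintype ι]
    (z : ι → ℝ) :
    ∑ l ∈ range N, (#{i | ramp (a + l * h) h (z i) ∈ Set.Ioo 0 h} : ℝ) ≤ Fintype.card ι := by
  have hcomm : ∑ l ∈ range N, #{i | ramp (a + l * h) h (z i) ∈ Set.Ioo 0 h} =
      ∑ i, #{l ∈ range N | ramp (a + (l : ℕ) * h) h (z i) ∈ Set.Ioo 0 h} :=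
    sum_card_bipartiteAbove_eq_sum_card_bipartiteBelow
      fun (l : ℕ) (i : ι) => ramp (a + l * h) h (z i) ∈ Set.Ioo 0 h
  have hle := hcomm.trans_le (sum_le_card_nsmul univ _ 1 fun i _ =>
    card_ramp_mem_Ioo_le_one hh a (z i) N)
  rw [smul_eq_mul, mul_one, card_univ] at hle
  exact_mod_cast hle

theorem abs_sum_abs_sub_sub_sum_ramp_le {ι : Type*} [Fintype ι] [LinearOrder ι] {a h : ℝ}
    (hh : 0 < h) (N : ℕ) {x y : ι → ℝ} (hx : Antitone x) (hy : Antitone y)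
    (hxI : ∀ i, x i ∈ Set.Icc a (a + N * h)) (hyI : ∀ i, y i ∈ Set.Icc a (a + N * h)) :
    |∑ i, |x i - y i| - (∑ l ∈ range N,
      |∑ i, ramp (a + l * h) h (x i) - ∑ i, ramp (a + l * h) h (y i)|)| ≤
        4 * h * Fintype.card ι := by
  have hsum : ∑ i, |x i - y i| = ∑ l ∈ range N, ∑ i,
      |ramp (a + l * h) h (x i) - ramp (a + l * h) h (y i)| := by
    rw [sum_comm]
    exact sum_congr rfl fun i _ => (sum_abs_ramp_sub_ramp hh.le (hxI i) (hyI i)).symm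
  have hlower (l : ℕ) : |∑ i, ramp (a + l * h) h (x i) - ∑ i, ramp (a + l * h) h (y i)| ≤
      ∑ i, |ramp (a + l * h) h (x i) - ramp (a + l * h) h (y i)| := by
    rw [← sum_sub_distrib]
    exact abs_sum_le_sum_abs _ _
  have hupper := sum_le_sum fun l (_ : l ∈ range N) => sum_abs_sub_le_of_monotone hh
    ((antitone_ramp (a + l * h) h).comp hx) ((antitone_ramp (a + l * h) h).comp hy)
    (fun _ => ramp_mem_Icc hh.le _ _) (fun _ => ramp_mem_Icc hh.le _ _)
  simp only [Function.comp_apply] at hupper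
  rw [sum_add_distrib, ← mul_sum, sum_add_distrib, ← hsum] at hupper
  have herror := mul_le_mul_of_nonneg_left (add_le_add (sum_card_ramp_mem_Ioo_le hh.le a N x)
    (sum_card_ramp_mem_Ioo_le hh.le a N y)) (by positivity : 0 ≤ 2 * h)
  rw [abs_of_nonneg (sub_nonneg.2 (hsum ▸ sum_le_sum fun l _ => hlower l))]
  linarith

theorem abs_sum_sub_sum_le_card_mul {ι : Type*} [Fintype ι] {f g : ι → ℝ} {η : ℝ}
    (h : ∀ i, |f i - g i| ≤ η) : |∑ i, f i - ∑ i, g i| ≤ Fintype.card ι * η := by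
  rw [← sum_sub_distrib, ← nsmul_eq_mul, ← card_univ]
  exact (abs_sum_le_sum_abs _ _).trans (sum_le_card_nsmul _ _ _ fun i _ => h i)

theorem abs_sum_abs_sub_sub_sum_abs_sub_le {κ ι : Type*} [Fintype κ] [Fintype ι]
    {f g : κ → ℝ → ℝ} {s : Set ℝ} {η : ℝ} (hfg : ∀ l, ∀ t ∈ s, |f l t - g l t| ≤ η)
    {x y : ι → ℝ} (hx : ∀ i, x i ∈ s) (hy : ∀ i, y i ∈ s) :
    |∑ l, |∑ i, f l (x i) - ∑ i, f l (y i)| - (∑ l, |∑ i, g l (x i) - ∑ i, g l (y i)|)| ≤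
      Fintype.card κ * (2 * (Fintype.card ι * η)) := by
  refine abs_sum_sub_sum_le_card_mul fun l => (abs_abs_sub_abs_le_abs_sub _ _).trans ?_
  rw [sub_sub_sub_comm, two_mul]
  exact (abs_sub _ _).trans (add_le_add (abs_sum_sub_sum_le_card_mul fun i => hfg l _ (hx i))
    (abs_sum_sub_sum_le_card_mul fun i => hfg l _ (hy i)))

theorem exists_forall_abs_sub_eval_le {κ : Type*} {f : κ → ℝ → ℝ} (hf : ∀ l, Continuous (f l))
    (a b : ℝ) {η : ℝ} (hη : 0 < η) :
    ∃ p : κ → ℝ[X], ∀ l, ∀ t ∈ Set.Icc a b, |f l t - (p l).eval t| ≤ η := by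
  choose p hp using fun l =>
    exists_polynomial_near_of_continuousOn a b (f l) (hf l).continuousOn η hη
  exact ⟨p, fun l t ht => abs_sub_comm ((p l).eval t) _ ▸ (hp l t ht).le⟩

theorem exists_polynomial_tests {B γ : ℝ} (hB : 0 < B) (hγ : 0 < γ) :
    ∃ (N : ℕ) (p : Fin N → ℝ[X]), ∀ (n : ℕ) (x y : Fin n → ℝ), Antitone x → Antitone y →
      (∀ i, |x i| ≤ B) → (∀ i, |y i| ≤ B) →
      |∑ i, |x i - y i| - (∑ l, |∑ i, (p l).eval (x i) - ∑ i, (p l).eval (y i)|)| ≤ γ * n := by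
  obtain ⟨N, hN⟩ := exists_nat_gt (16 * B / γ)
  have hN0 : (0 : ℝ) < N := lt_trans (by positivity) hN
  set h := 2 * B / N with hh
  have hh0 : 0 < h := by positivity
  have hB' : -B + N * h = B := by
    rw [hh]
    field_simp
    ring
  have hhγ : 4 * h ≤ γ / 2 := by
    rw [div_lt_iff₀ hγ] at hN
    rw [hh, mul_div_assoc', div_le_iff₀ hN0]
    linarith
  obtain ⟨p, hp⟩ := exists_forall_abs_sub_eval_le
    (fun l : Fin N => continuous_ramp (-B + (l : ℕ) * h) h) (-B) B (η := γ / (4 * N))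
    (by positivity)
  refine ⟨N, p, fun n x y hx hy hxB hyB => ?_⟩
  have hxI (i) : x i ∈ Set.Icc (-B) B := abs_le.1 (hxB i)
  have hyI (i) : y i ∈ Set.Icc (-B) B := abs_le.1 (hyB i)
  have hramp := abs_sum_abs_sub_sub_sum_ramp_le hh0 N hx hy (a := -B) (by rwa [hB'])
    (by rwa [hB'])
  rw [← Fin.sum_univ_eq_sum_range
    (fun l => |∑ i, ramp (-B + l * h) h (x i) - ∑ i, ramp (-B + l * h) h (y i)|),
    Fintype.card_fin] at hramp
  have hpoly := abs_sum_abs_sub_sub_sum_abs_sub_le hp hxI hyI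
  have herror : (N : ℝ) * (2 * (n * (γ / (4 * N)))) = γ / 2 * n := by
    field_simp
    ring
  rw [Fintype.card_fin, Fintype.card_fin, herror] at hpoly
  have hle : 4 * h * n ≤ γ / 2 * n := by gcongr
  exact (abs_sub_le _ _ _).trans ((add_le_add (hramp.trans hle) hpoly).trans_eq (by ring))

end SortedDistance

/-! ### Traces of polynomials of the normalized Laplacian -/

section Trace

theorem trace_aeval_eq_sum_eval_eigenvalues {ι : Type*} [Fintype ι] [DecidableEq ι]
    {A : Matrix ι ι ℝ} (hA : A.IsHermitian) (p : ℝ[X]) :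
    (aeval A p).trace = ∑ i, p.eval (hA.eigenvalues i) := by
  have trace_pow (m : ℕ) : (A ^ m).trace = ∑ i, hA.eigenvalues i ^ m := by
    conv_lhs => rw [hA.spectral_theorem, ← map_pow, Unitary.conjStarAlgAut_apply,
      Matrix.trace_mul_comm, ← mul_assoc]
    simp [Matrix.diagonal_pow, Matrix.trace]
  simp only [aeval_eq_sum_range, eval_eq_sum_range, Matrix.trace_sum, Matrix.trace_smul,
    trace_pow, smul_eq_mul, mul_sum]
  exact sum_comm

theorem norm_aeval_le {A : Type*} [NormedRing A] [NormedAlgebra ℝ A] [NormOneClass A] {a : A}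
    {r : ℝ} (ha : ‖a‖ ≤ r) (p : ℝ[X]) :
    ‖aeval a p‖ ≤ ∑ m ∈ range (p.natDegree + 1), |p.coeff m| * r ^ m := by
  rw [aeval_eq_sum_range]
  refine (norm_sum_le _ _).trans (sum_le_sum fun m _ => ?_)
  rw [norm_smul, Real.norm_eq_abs]
  gcongr
  exact (norm_pow_le a m).trans (by gcongr)

variable {V W : Type*} [Fintype V] [Fintype W] [DecidableEq V] [DecidableEq W]
  {G : SimpleGraph V} {H : SimpleGraph W} {d L : ℕ} {p : ℝ[X]} {v : V} {w : W}

theorem sum_abs_normalizedLaplacian_le (hG : ∀ v, G.degree v ≤ d) (x : V) :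
    ∑ y, |normalizedLaplacian G x y| ≤ d + 1 := by
  have hzero (y : V) (hne : x ≠ y) (hadj : ¬G.Adj x y) : |normalizedLaplacian G x y| = 0 := by
    rw [normalizedLaplacian_eq_zero hne hadj, abs_zero]
  rw [sum_eq_add_sum_neighborFinset hzero, add_comm]
  refine add_le_add ?_ (abs_normalizedLaplacian_le_one G x x)
  refine (sum_le_card_nsmul _ _ 1 fun y _ => abs_normalizedLaplacian_le_one G x y).trans ?_
  rw [nsmul_one]
  exact_mod_cast hG x

attribute [local instance] Matrix.linftyOpNormedRing Matrix.linftyOpNormedAlgebra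

theorem abs_eigenvalues_le_linfty_opNorm {A : Matrix V V ℝ} (hA : A.IsHermitian) (v : V) :
    |hA.eigenvalues v| ≤ ‖A‖ := by
  have : Nonempty V := ⟨v⟩
  have : NormOneClass (Matrix V V ℝ) := Matrix.linfty_opNormOneClass
  have : CompleteSpace (Matrix V V ℝ) := FiniteDimensional.complete ℝ _
  exact spectrum.norm_le_norm_of_mem (hA.eigenvalues_mem_spectrum_real v)

theorem norm_apply_le_linfty_opNorm (A : Matrix V V ℝ) (x y : V) : ‖A x y‖ ≤ ‖A‖ := by
  rw [Matrix.linfty_opNorm_def]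
  have h1 := le_sup (f := fun x => ∑ y, ‖A x y‖₊) (mem_univ x)
  have h2 := single_le_sum (f := fun y => ‖A x y‖₊) (fun _ _ => zero_le) (mem_univ y)
  exact_mod_cast h2.trans h1

theorem norm_normalizedLaplacian_le (hG : ∀ v, G.degree v ≤ d) :
    ‖normalizedLaplacian G‖ ≤ d + 1 := by
  rw [Matrix.linfty_opNorm_def]
  suffices h : (univ.sup fun x => ∑ y, ‖normalizedLaplacian G x y‖₊) ≤ (d + 1 : NNReal) by
    exact_mod_cast h
  refine Finset.sup_le fun x _ => NNReal.coe_le_coe.1 ?_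
  simpa using sum_abs_normalizedLaplacian_le hG x

/-- The diagonal entry at `v` of the polynomial `p` of the normalized Laplacian: the contribution
of `v` to the trace `polyTrace p G`. -/
def localEval (p : ℝ[X]) (G : SimpleGraph V) (v : V) : ℝ :=
  aeval (normalizedLaplacian G) p v v

/-- The trace of the polynomial `p` of the normalized Laplacian. -/
def polyTrace (p : ℝ[X]) (G : SimpleGraph V) : ℝ := ∑ v, localEval p G v

/-- A bound for `|localEval p G v|` in graphs of maximal degree at most `d`. -/
def evalBound (p : ℝ[X]) (d : ℕ) : ℝ :=
  ∑ m ∈ range (p.natDegree + 1), |p.coeff m| * (d + 1) ^ m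

theorem evalBound_nonneg (p : ℝ[X]) (d : ℕ) : 0 ≤ evalBound p d :=
  sum_nonneg fun _ _ => by positivity

theorem abs_localEval_le (p : ℝ[X]) (hG : ∀ v, G.degree v ≤ d) (v : V) :
    |localEval p G v| ≤ evalBound p d := by
  have : Nonempty V := ⟨v⟩
  have : NormOneClass (Matrix V V ℝ) := Matrix.linfty_opNormOneClass
  exact (norm_apply_le_linfty_opNorm _ v v).trans
    (norm_aeval_le (norm_normalizedLaplacian_le hG) p)

theorem localEval_eq_of_color_eq (hp : p.natDegree ≤ L) (hG : (L : ℕ∞) < G.egirth)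
    (hH : (L : ℕ∞) < H.egirth) (h : color G (L + 1) v = color H (L + 1) w) :
    localEval p G v = localEval p H w := by
  simp only [localEval, aeval_eq_sum_range, Matrix.sum_apply, Matrix.smul_apply]
  refine sum_congr rfl fun m hm => ?_
  have hmL : m ≤ L := (Nat.lt_succ_iff.1 (mem_range.1 hm)).trans hp
  have hmL' : (m : ℕ∞) ≤ L := by exact_mod_cast hmL
  rw [normalizedLaplacian_pow_apply_self_eq_of_color_eq (hmL'.trans_lt hG) (hmL'.trans_lt hH)
    (color_eq_color_of_le (by lia) h)]

section Spectrum

variable {n d : ℕ} {G H : SimpleGraph (Fin n)}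

theorem exists_graphSpectrum_eq_eigenvalues (G : SimpleGraph (Fin n)) :
    ∃ e : Fin n ≃ Fin n, ∀ i,
      graphSpectrum G i = (normLaplacian_isHermitian G).eigenvalues (e i) :=
  ⟨(finCongr (Fintype.card_fin n).symm).trans (Fintype.equivOfCardEq (Fintype.card_fin _)),
    fun i => by simp [graphSpectrum, Matrix.IsHermitian.eigenvalues, finCongr]⟩

theorem sum_eval_graphSpectrum (p : ℝ[X]) (G : SimpleGraph (Fin n)) :
    ∑ i, p.eval (graphSpectrum G i) = polyTrace p G := by
  obtain ⟨e, he⟩ := exists_graphSpectrum_eq_eigenvalues G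
  simp only [he]
  rw [e.sum_comp fun i => p.eval ((normLaplacian_isHermitian G).eigenvalues i),
    ← trace_aeval_eq_sum_eval_eigenvalues, normLaplacian_eq_normalizedLaplacian]
  rfl

theorem abs_graphSpectrum_le (hG : DegreeBounded d G) (i : Fin n) :
    |graphSpectrum G i| ≤ d + 1 := by
  obtain ⟨e, he⟩ := exists_graphSpectrum_eq_eigenvalues G
  rw [he]
  refine (abs_eigenvalues_le_linfty_opNorm _ _).trans ?_
  rw [normLaplacian_eq_normalizedLaplacian]
  exact norm_normalizedLaplacian_le hG

theorem antitone_graphSpectrum (G : SimpleGraph (Fin n)) : Antitone (graphSpectrum G) :=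
  fun _ _ hij => (normLaplacian_isHermitian G).eigenvalues₀_antitone (by simpa using hij)

theorem exists_trace_tests (d : ℕ) {γ : ℝ} (hγ : 0 < γ) :
    ∃ (N : ℕ) (p : Fin N → ℝ[X]), ∀ (n : ℕ) (G H : SimpleGraph (Fin n)),
      DegreeBounded d G → DegreeBounded d H →
      |∑ i, |graphSpectrum G i - graphSpectrum H i| -
        (∑ l, |polyTrace (p l) G - polyTrace (p l) H|)| ≤ γ * n := by
  obtain ⟨N, p, h⟩ := exists_polynomial_tests (B := d + 1) (by positivity) hγ
  refine ⟨N, p, fun n G H hG hH => ?_⟩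
  simpa only [sum_eval_graphSpectrum] using h n _ _ (antitone_graphSpectrum G)
    (antitone_graphSpectrum H) (abs_graphSpectrum_le hG) (abs_graphSpectrum_le hH)

end Spectrum

end Trace

/-! ### Girth and distances after adding an edge -/

section SupEdge

open SimpleGraph

variable {V : Type*} {G : SimpleGraph V} {a b x y : V} {e : Sym2 V}

theorem min_edist_le_edist_sup_edge :
    min (G.edist x y) (min (G.edist x a) (G.edist x b)) ≤ (G ⊔ edge a b).edist x y := by
  refine le_iInf fun p => ?_
  induction p with
  | nil => simp
  | @cons x z y h p ih =>
    rcases h with h | h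
    · have hstep (c : V) : G.edist x c ≤ G.edist z c + 1 := by
        simpa only [edist_eq_one_iff_adj.2 h, add_comm] using
          G.edist_triangle (u := x) (v := z) (w := c)
      refine (min_le_min (hstep y) (min_le_min (hstep a) (hstep b))).trans ?_
      simpa only [min_add_add_right, Walk.length_cons, Nat.cast_add, Nat.cast_one]
        using add_le_add_left ih 1
    · rcases ((edge_adj a b x z).1 h).1 with ⟨rfl, -⟩ | ⟨rfl, -⟩ <;> simp

theorem egirth_le_edist_deleteEdges_add_one (h : G.Adj a b) (he : e = s(a, b)) :
    G.egirth ≤ (G.deleteEdges {e}).edist b a + 1 := by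
  by_cases htop : (G.deleteEdges {e}).edist b a = ⊤
  · simp only [htop, top_add, le_top]
  obtain ⟨p, hp⟩ := exists_walk_of_edist_ne_top htop
  have hcycle : ((p.bypass.mapLe (deleteEdges_le {e})).cons h).IsCycle := by
    refine (Walk.cons_isCycle_iff _ h).2 ⟨p.bypass_isPath.mapLe _, fun hmem => ?_⟩
    rw [Walk.edges_mapLe_eq_edges, ← he] at hmem
    simpa using p.bypass.edges_subset_edgeSet hmem
  have hlen := (egirth_le_length hcycle).trans
    (Nat.cast_le.2 (Nat.succ_le_succ ((p.bypass.length_map _).trans_le p.length_bypass_le_length)))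
  simpa only [← hp, Nat.cast_succ] using hlen

theorem mem_edgeSet_of_mem_edgeSet_sup_edge (h : e ∈ (G ⊔ edge a b).edgeSet) (he : e ≠ s(a, b)) :
    e ∈ G.edgeSet := by
  rw [edgeSet_sup] at h
  exact h.resolve_right fun h' => he (edgeSet_edge_subset h')

theorem edist_add_one_le_length_of_snd_eq {c : (G ⊔ edge a b).Walk a a} (hc : c.IsCycle)
    (hb : c.snd = b) : G.edist a b + 1 ≤ c.length := by
  cases c with
  | nil => exact absurd hc Walk.not_isCycle_nil
  | cons h p =>
    obtain rfl : _ = b := by simpa using hb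
    have hG : ∀ e ∈ p.reverse.edges, e ∈ G.edgeSet := fun e he =>
      mem_edgeSet_of_mem_edgeSet_sup_edge (p.reverse.edges_subset_edgeSet he) fun h' =>
        ((Walk.cons_isCycle_iff p h).1 hc).2 (h' ▸ by simpa using he)
    simpa using add_le_add_left (p.reverse.transfer G hG).edist_le 1

theorem snd_eq_or_snd_reverse_eq {c : G.Walk a a} (hc : c.IsCycle) (hb : s(a, b) ∈ c.edges) :
    c.snd = b ∨ c.reverse.snd = b := by
  cases c with
  | nil => exact absurd hc Walk.not_isCycle_nil
  | cons h p =>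
    rw [Walk.edges_cons, List.mem_cons] at hb
    rcases hb with hb | hb
    · exact .inl (by simpa using (Sym2.congr_right.1 hb).symm)
    · have hp : ¬ p.Nil := fun hp => by simp [Walk.edges_eq_nil.2 hp] at hb
      have hpath := ((Walk.cons_isCycle_iff p h).1 hc).1
      rw [Walk.snd_reverse, Walk.penultimate_cons_of_not_nil h p hp]
      exact .inr (hpath.eq_penultimate_of_mem_edges hb).symm

theorem min_egirth_le_egirth_sup_edge :
    min G.egirth (G.edist a b + 1) ≤ (G ⊔ edge a b).egirth := by
  refine le_egirth.2 fun x c hc => ?_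
  by_cases hab : s(a, b) ∈ c.edges
  · have ha := c.fst_mem_support_of_mem_edges hab
    have hab' := (c.rotate_edges a ha).mem_iff.2 hab
    rw [← c.length_rotate a ha]
    refine (min_le_right _ _).trans ?_
    rcases snd_eq_or_snd_reverse_eq (hc.rotate ha) hab' with hb | hb
    · exact edist_add_one_le_length_of_snd_eq (hc.rotate ha) hb
    · simpa using edist_add_one_le_length_of_snd_eq (hc.rotate ha).reverse hb
  · have hG : ∀ e ∈ c.edges, e ∈ G.edgeSet := fun e he =>
      mem_edgeSet_of_mem_edgeSet_sup_edge (c.edges_subset_edgeSet he) fun h => hab (h ▸ he)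
    exact (min_le_left _ _).trans (by simpa using egirth_le_length (hc.transfer hG))

end SupEdge

/-! ### Swapping two far apart edges -/

section Swap

open SimpleGraph

variable {V : Type*} {G : SimpleGraph V} {L : ℕ} {u v u' v' : V}

/-- The graph obtained from `G` by replacing the edges `s(u, v)` and `s(u', v')` by `s(u, u')` and
`s(v, v')`. -/
def swap (G : SimpleGraph V) (u v u' v' : V) : SimpleGraph V :=
  G.deleteEdges {s(u, v), s(u', v')} ⊔ edge u u' ⊔ edge v v'

theorem swap_adj {x y : V} : (swap G u v u' v').Adj x y ↔
    (G.Adj x y ∧ s(x, y) ≠ s(u, v) ∧ s(x, y) ≠ s(u', v')) ∨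
      ((s(x, y) = s(u, u') ∨ s(x, y) = s(v, v')) ∧ x ≠ y) := by
  simp only [swap, sup_adj, deleteEdges_adj, edge_adj, Set.mem_insert_iff,
    Set.mem_singleton_iff, Sym2.eq_iff, ne_eq, not_or, or_and_right, or_assoc, and_assoc]

/-- `s(u, v)` and `s(u', v')` are edges of `G` at distance larger than `L` from each other.
Swapping such edges creates no cycle of length at most `L`. -/
structure FarEdges (G : SimpleGraph V) (L : ℕ) (u v u' v' : V) : Prop where
  left : G.Adj u v
  right : G.Adj u' v'
  far : ∀ a ∈ s(u, v), ∀ b ∈ s(u', v'), (L : ℕ∞) < G.edist a b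

theorem swap_comm : swap G u v u' v' = swap G u' v' u v := by
  simp only [swap, Set.pair_comm s(u, v), edge_comm u u', edge_comm v v']

theorem swap_flip : swap G u v u' v' = swap G v u v' u' := by
  simp only [swap, Sym2.eq_swap (a := u), Sym2.eq_swap (a := u'), sup_assoc,
    sup_comm (edge u u')]

theorem FarEdges.comm (h : FarEdges G L u v u' v') : FarEdges G L u' v' u v :=
  ⟨h.right, h.left, fun a ha b hb => edist_comm (G := G) ▸ h.far b hb a ha⟩

theorem FarEdges.flip (h : FarEdges G L u v u' v') : FarEdges G L v u v' u' :=
  ⟨h.left.symm, h.right.symm, by simpa only [Sym2.eq_swap] using h.far⟩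

theorem FarEdges.not_adj_or_eq (h : FarEdges G L u v u' v') (hL : 1 ≤ L) {a b : V}
    (ha : a ∈ s(u, v)) (hb : b ∈ s(u', v')) : ¬ (G.Adj a b ∨ a = b) := by
  rw [← edist_le_one_iff_adj_or_eq, not_le]
  exact (Nat.one_le_cast.2 hL).trans_lt (h.far a ha b hb)

theorem lt_egirth_swap (h : FarEdges G L u v u' v') (hG : (L : ℕ∞) < G.egirth) :
    (L : ℕ∞) < (swap G u v u' v').egirth := by
  have hfar {a b : V} (ha : a ∈ s(u, v)) (hb : b ∈ s(u', v')) :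
      (L : ℕ∞) ≤ (G.deleteEdges {s(u, v), s(u', v')}).edist a b :=
    (h.far a ha b hb).le.trans (edist_anti (deleteEdges_le _))
  have hvu : (L : ℕ∞) ≤ (G.deleteEdges {s(u, v), s(u', v')}).edist v u :=
    (Order.le_of_lt_add_one (hG.trans_le (egirth_le_edist_deleteEdges_add_one h.left rfl))).trans
      (edist_anti (deleteEdges_anti (by simp)))
  have hvv' := (le_min (hfar (by simp) (by simp)) (le_min hvu (hfar (by simp) (by simp)))).trans
    (min_edist_le_edist_sup_edge (x := v) (y := v') (a := u) (b := u'))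
  have hadd {m : ℕ∞} : (L : ℕ∞) ≤ m → (L : ℕ∞) < m + 1 :=
    (ENat.lt_add_one_iff' (ENat.natCast_ne_top L)).2
  have hsup : (L : ℕ∞) < (G.deleteEdges {s(u, v), s(u', v')} ⊔ edge u u').egirth :=
    (lt_min (hG.trans_le (egirth_anti (deleteEdges_le _)))
      (hadd (hfar (by simp) (by simp)))).trans_le min_egirth_le_egirth_sup_edge
  exact (lt_min hsup (hadd hvv')).trans_le min_egirth_le_egirth_sup_edge

theorem ncard_symmDiff_swap_le [Finite V] (G₀ : SimpleGraph V) :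
    (symmDiff G₀.edgeSet (swap G u v u' v').edgeSet).ncard ≤
      (symmDiff G₀.edgeSet G.edgeSet).ncard + 4 := by
  have hsub : symmDiff G₀.edgeSet (swap G u v u' v').edgeSet ⊆
      symmDiff G₀.edgeSet G.edgeSet ∪ (({s(u, v), s(u', v'), s(u, u'), s(v, v')} :
        Finset (Sym2 V)) : Set (Sym2 V)) := by
    intro e he
    induction e with
    | _ x y =>
      simp only [Set.mem_symmDiff, mem_edgeSet, swap_adj, Set.mem_union, coe_insert,
        coe_singleton, Set.mem_insert_iff, Set.mem_singleton_iff] at he ⊢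
      tauto
  refine (Set.ncard_le_ncard hsub (Set.toFinite _)).trans ((Set.ncard_union_le _ _).trans ?_)
  rw [Set.ncard_coe_finset]
  exact Nat.add_le_add_left card_le_four _

variable [Fintype V]

theorem neighborFinset_swap_left (h : FarEdges G L u v u' v') (hL : 1 ≤ L) :
    (swap G u v u' v').neighborFinset u = insert u' ((G.neighborFinset u).erase v) := by
  have huu' := h.not_adj_or_eq hL (a := u) (b := u') (by simp) (by simp)
  have huv' := h.not_adj_or_eq hL (a := u) (b := v') (by simp) (by simp)
  have := h.left.ne
  ext y
  simp only [mem_neighborFinset, swap_adj, Sym2.eq_iff, mem_insert, mem_erase]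
  grind

theorem map_insert_erase {α β : Type*} {s : Finset α} {a b : α} (ha : a ∈ s) (hb : b ∉ s)
    {f : α → β} (hf : f a = f b) : (insert b (s.erase a)).val.map f = s.val.map f := by
  rw [insert_val_of_notMem fun h => hb (mem_of_mem_erase h), Multiset.map_cons, ← hf,
    ← Multiset.map_cons, erase_val, Multiset.cons_erase ha]

theorem map_neighborFinset_swap_left (h : FarEdges G L u v u' v') (hL : 1 ≤ L) {β : Type*}
    {f : V → β} (hf : f v = f u') :
    ((swap G u v u' v').neighborFinset u).val.map f = (G.neighborFinset u).val.map f := by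
  have hne := h.not_adj_or_eq hL (a := u) (b := u') (by simp) (by simp)
  rw [neighborFinset_swap_left h hL]
  exact map_insert_erase (by simpa using h.left) (by simpa using fun h' => hne (.inl h')) hf

theorem map_neighborFinset_swap (h : FarEdges G L u v u' v') (hL : 1 ≤ L) {β : Type*}
    {f : V → β} (hu : f u = f v') (hv : f v = f u') (x : V) :
    ((swap G u v u' v').neighborFinset x).val.map f = (G.neighborFinset x).val.map f := by
  by_cases hx : x = u ∨ x = v ∨ x = u' ∨ x = v'
  · rcases hx with rfl | rfl | rfl | rfl
    · exact map_neighborFinset_swap_left h hL hv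
    · rw [swap_flip]
      exact map_neighborFinset_swap_left h.flip hL hu
    · rw [swap_comm]
      exact map_neighborFinset_swap_left h.comm hL hu.symm
    · rw [swap_comm, swap_flip]
      exact map_neighborFinset_swap_left h.comm.flip hL hv.symm
  · congr 2
    ext y
    simp only [mem_neighborFinset, swap_adj, Sym2.eq_iff]
    grind

theorem color_swap (h : FarEdges G L u v u' v') (hL : 1 ≤ L) {j k : ℕ}
    (hu : color G k u = color G k v') (hv : color G k v = color G k u') (hj : j ≤ k + 1) :
    color (swap G u v u' v') j = color G j := by
  induction j with
  | zero => rfl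
  | succ j ih =>
    funext x
    have hjk := Nat.le_of_succ_le_succ hj
    rw [color_succ_eq_color_succ_iff, ih (Nat.le_succ_of_le hjk)]
    exact map_neighborFinset_swap h hL (color_eq_color_of_le hjk hu)
      (color_eq_color_of_le hjk hv) x

/-- The number of edges of `G` between `U` and its complement. -/
def cutSize (G : SimpleGraph V) (U : Finset V) : ℕ := #(G.interedges U Uᶜ)

theorem cutSize_swap_add_two_le (h : FarEdges G L u v u' v') (hL : 1 ≤ L) {U : Finset V}
    (hu : u ∈ U) (hv : v ∉ U) (hu' : u' ∈ U) (hv' : v' ∉ U) :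
    cutSize (swap G u v u' v') U + 2 ≤ cutSize G U := by
  have hne : u ≠ u' := fun h' => h.not_adj_or_eq hL (by simp) (by simp) (.inr h')
  have hsub : (swap G u v u' v').interedges U Uᶜ ⊆ G.interedges U Uᶜ \ {(u, v), (u', v')} := by
    rintro ⟨x, y⟩ hxy
    simp only [mem_interedges_iff, mem_compl, swap_adj, Sym2.eq_iff, mem_sdiff, mem_insert,
      mem_singleton, Prod.mk.injEq] at hxy ⊢
    grind
  have hpair : {(u, v), (u', v')} ⊆ G.interedges U Uᶜ := by
    simp [insert_subset_iff, mem_interedges_iff, hu, hv, hu', hv', h.left, h.right]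
  have hcard : #{(u, v), (u', v')} = 2 := card_pair (by simp [hne])
  have hle := card_le_card hsub
  rw [card_sdiff_of_subset hpair, hcard] at hle
  have := card_le_card hpair
  simp only [cutSize]
  lia

end Swap

/-! ### Balls and reduced cuts -/

section Reduced

open SimpleGraph

variable {V : Type*} [Fintype V] {G : SimpleGraph V} {d L k : ℕ}

/-- The closed ball of radius `R` around `x` in the graph distance of `G`, as a finite set. -/
def closedBall (G : SimpleGraph V) (R : ℕ) (x : V) : Finset V := {y | G.edist x y ≤ R}

theorem mem_closedBall {R : ℕ} {x y : V} : y ∈ closedBall G R x ↔ G.edist x y ≤ R :=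
  mem_filter_univ y

theorem closedBall_zero {x : V} : closedBall G 0 x = {x} := by
  ext y
  simp [mem_closedBall, eq_comm (a := y)]

theorem closedBall_succ_subset (R : ℕ) (x : V) :
    closedBall G (R + 1) x ⊆ (insert x (G.neighborFinset x)).biUnion (closedBall G R) := by
  intro y hy
  rw [mem_closedBall] at hy
  obtain ⟨p, hp⟩ := exists_walk_of_edist_ne_top (ne_top_of_le_ne_top (ENat.natCast_ne_top _) hy)
  rw [← hp, Nat.cast_le] at hy
  rw [mem_biUnion]
  cases p with
  | nil => exact ⟨x, mem_insert_self _ _, mem_closedBall.2 (by simp)⟩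
  | @cons _ z _ h p =>
    exact ⟨z, mem_insert_of_mem ((mem_neighborFinset _ _ _).2 h),
      mem_closedBall.2 (p.edist_le.trans (Nat.cast_le.2 (Nat.le_of_succ_le_succ hy)))⟩

theorem card_closedBall_le (hG : ∀ v, G.degree v ≤ d) (R : ℕ) (x : V) :
    #(closedBall G R x) ≤ (d + 1) ^ R := by
  induction R generalizing x with
  | zero => simp [closedBall_zero]
  | succ R ih =>
    calc
      _ ≤ _ := card_le_card (closedBall_succ_subset R x)
      _ ≤ #(insert x (G.neighborFinset x)) * (d + 1) ^ R :=
        card_biUnion_le_card_mul _ _ _ fun y _ => ih y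
      _ ≤ (d + 1) * (d + 1) ^ R := by
        gcongr
        exact (card_insert_le _ _).trans (Nat.add_le_add_right (hG x) 1)
      _ = _ := (pow_succ' _ _).symm

/-- The set `U` is reduced if no two edges leaving it, whose ends have matching colours at level
`k`, are so far apart that they could be swapped. -/
def IsReduced (G : SimpleGraph V) (L k : ℕ) (U : Finset V) : Prop :=
  ∀ e ∈ G.interedges U Uᶜ, ∀ e' ∈ G.interedges U Uᶜ, color G k e.1 = color G k e'.2 →
    color G k e.2 = color G k e'.1 → e'.1 ∈ closedBall G (L + 2) e.1

theorem farEdges_of_notMem_closedBall {u v u' v' : V} (h : G.Adj u v) (h' : G.Adj u' v')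
    (hu' : u' ∉ closedBall G (L + 2) u) : FarEdges G L u v u' v' := by
  refine ⟨h, h', fun a ha b hb => lt_of_not_ge fun hab => hu' (mem_closedBall.2 ?_)⟩
  have hua : G.edist u a ≤ 1 := by
    rcases Sym2.mem_iff.1 ha with rfl | rfl
    · simp
    · exact (edist_eq_one_iff_adj.2 h).le
  have hbu' : G.edist b u' ≤ 1 := by
    rcases Sym2.mem_iff.1 hb with rfl | rfl
    · simp
    · exact (edist_eq_one_iff_adj.2 h'.symm).le
  calc
    G.edist u u' ≤ G.edist u a + (G.edist a b + G.edist b u') :=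
      G.edist_triangle.trans (add_le_add_right G.edist_triangle _)
    _ ≤ 1 + (L + 1) := by gcongr
    _ = (L + 2 : ℕ) := by push_cast; ring

-- Among the graphs that arise from `G₀` by swaps, take one with the fewest edges leaving `U`.
theorem exists_isReduced (G₀ : SimpleGraph V) (U : Finset V) (k : ℕ) (hL : 1 ≤ L)
    (hg : (L : ℕ∞) < G₀.egirth) : ∃ G : SimpleGraph V,
      (∀ j ≤ k + 1, color G j = color G₀ j) ∧ (L : ℕ∞) < G.egirth ∧
      (symmDiff G₀.edgeSet G.edgeSet).ncard + 2 * cutSize G U ≤ 2 * cutSize G₀ U ∧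
      IsReduced G L k U := by
  let good : Set (SimpleGraph V) := {G | (∀ j ≤ k + 1, color G j = color G₀ j) ∧
    (L : ℕ∞) < G.egirth ∧ (symmDiff G₀.edgeSet G.edgeSet).ncard + 2 * cutSize G U ≤
      2 * cutSize G₀ U}
  have hgood : good.Nonempty := ⟨G₀, fun _ _ => rfl, hg, by simp⟩
  obtain ⟨G, ⟨hcolor, hgirth, hdiff⟩, hmin⟩ :=
    (Set.toFinite good).exists_minimalFor (fun G => cutSize G U) _ hgood
  refine ⟨G, hcolor, hgirth, hdiff, ?_⟩
  rintro ⟨u, v⟩ he ⟨u', v'⟩ he' huv' hvu'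
  simp only [mem_interedges_iff, mem_compl] at he he' huv' hvu'
  by_contra hball
  have hfar := farEdges_of_notMem_closedBall he.2.2 he'.2.2 hball
  have hcut := cutSize_swap_add_two_le hfar hL he.1 he.2.1 he'.1 he'.2.1
  have hdiff' := ncard_symmDiff_swap_le (G := G) (u := u) (v := v) (u' := u') (v' := v') G₀
  have hswap : swap G u v u' v' ∈ good :=
    ⟨fun j hj => (color_swap hfar hL huv' hvu' hj).trans (hcolor j hj),
      lt_egirth_swap hfar hgirth, by lia⟩
  have := hmin hswap (by dsimp only; lia)
  dsimp only at this
  lia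

end Reduced

/-! ### Proportional sets -/

section Proportional

theorem sum_filter_eq_card_mul {V : Type*} {c : V → ℕ} {f : V → ℝ} {s : Finset V}
    {a : ℕ} {z : V} (hz : ∀ x, c x = a → f x = f z) :
    ∑ x ∈ s with c x = a, f x = #{x ∈ s | c x = a} * f z := by
  rw [sum_congr rfl fun x hx => hz x (mem_filter.1 hx).2, sum_const, nsmul_eq_mul]

variable {V : Type*} [Fintype V] {c : V → ℕ} {ρ C : ℝ} {U : Finset V} {K : Finset ℕ} {f : V → ℝ}

/-- The set `U` contains a proportion of `ρ` of each class of the colouring `c`, up to one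
vertex. -/
def Proportional (c : V → ℕ) (ρ : ℝ) (U : Finset V) : Prop :=
  ∀ a, |(#{x ∈ U | c x = a} : ℝ) - ρ * #{x | c x = a}| ≤ 1

theorem exists_proportional (c : V → ℕ) (hρ : 0 ≤ ρ) (hρ1 : ρ ≤ 1) :
    ∃ U : Finset V, Proportional c ρ U := by
  have hex (a : ℕ) : ∃ T ⊆ ({x | c x = a} : Finset V), #T = ⌊ρ * #{x | c x = a}⌋₊ :=
    exists_subset_card_eq (Nat.floor_le_of_le (mul_le_of_le_one_left (Nat.cast_nonneg _) hρ1))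
  choose T hT hcard using hex
  refine ⟨({x | x ∈ T (c x)} : Finset V), fun a => ?_⟩
  have hclass : ({x ∈ ({x | x ∈ T (c x)} : Finset V) | c x = a} : Finset V) = T a := by
    ext x
    have hx : x ∈ T a → c x = a := fun h => by simpa using hT a h
    simp only [mem_filter, mem_univ, true_and]
    exact ⟨fun h => h.2 ▸ h.1, fun h => ⟨(hx h).symm ▸ h, hx h⟩⟩
  have hnonneg : 0 ≤ ρ * (#{x | c x = a} : ℝ) := by positivity
  rw [hclass, hcard, abs_sub_comm, abs_of_nonneg (sub_nonneg.2 (Nat.floor_le hnonneg))]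
  linarith [Nat.lt_floor_add_one (ρ * (#{x | c x = a} : ℝ))]

theorem Proportional.abs_sum_sub_le (hU : Proportional c ρ U) (hK : ∀ x, c x ∈ K) (hC : 0 ≤ C)
    (hf : ∀ x y, c x = c y → f x = f y) (hfC : ∀ x, |f x| ≤ C) :
    |∑ x ∈ U, f x - ρ * ∑ x, f x| ≤ #K * C := by
  rw [← sum_fiberwise_of_maps_to (fun x _ => hK x) f,
    ← sum_fiberwise_of_maps_to (fun x _ => hK x) f, mul_sum, ← sum_sub_distrib]
  refine (abs_sum_le_sum_abs _ _).trans ((sum_le_card_nsmul K _ C fun a _ => ?_).trans_eq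
    (nsmul_eq_mul _ _))
  by_cases ha : ∃ z, c z = a
  · obtain ⟨z, rfl⟩ := ha
    rw [sum_filter_eq_card_mul fun x => hf x z, sum_filter_eq_card_mul fun x => hf x z,
      ← mul_assoc, ← sub_mul, abs_mul]
    exact (mul_le_of_le_one_left (abs_nonneg _) (hU _)).trans (hfC z)
  · have hempty (s : Finset V) : ({x ∈ s | c x = a} : Finset V) = ∅ :=
      filter_eq_empty_iff.2 fun x _ hx => ha ⟨x, hx⟩
    simpa [hempty] using hC

end Proportional

section Cut

theorem card_interedges_comm {V : Type*} (G : SimpleGraph V) (S T : Finset V) :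
    #(G.interedges S T) = #(G.interedges T S) :=
  have := G.symm
  Rel.card_interedges_comm S T

theorem card_interedges_inter_add_sdiff {V : Type*} (G : SimpleGraph V)
    (S T U : Finset V) :
    #(G.interedges S (T ∩ U)) + #(G.interedges S (T \ U)) = #(G.interedges S T) := by
  rw [← card_filter_add_card_filter_not (s := G.interedges S T) fun e => e.2 ∈ U]
  congr 2 <;>
  · ext e
    simp only [SimpleGraph.mem_interedges_iff, mem_filter, mem_inter, mem_sdiff]
    tauto

variable {V : Type*} [Fintype V] {G : SimpleGraph V} {d L k : ℕ} {ρ : ℝ} {U : Finset V}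
  {K K' : Finset ℕ}

/-- The set of vertices whose colour at level `k` is `a`. -/
def colorClass (G : SimpleGraph V) (k a : ℕ) : Finset V := {x | color G k x = a}

theorem mem_colorClass {x : V} {a : ℕ} : x ∈ colorClass G k a ↔ color G k x = a :=
  mem_filter_univ x

theorem card_interedges_eq_sum (G : SimpleGraph V) (S T : Finset V) :
    #(G.interedges S T) = ∑ x ∈ S, #{y ∈ G.neighborFinset x | y ∈ T} := by
  simp only [SimpleGraph.interedges, Rel.interedges, card_filter, sum_product]
  refine sum_congr rfl fun x _ => ?_
  rw [← sum_filter, ← sum_filter]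
  refine sum_congr ?_ fun _ _ => rfl
  ext y
  simp [and_comm]

theorem abs_card_interedges_sub_le (hG : ∀ v, G.degree v ≤ d)
    (hU : Proportional (color G (k + 1)) ρ U) (hK' : ∀ x, color G (k + 1) x ∈ K') (a b : ℕ) :
    |(#(G.interedges (colorClass G k a ∩ U) (colorClass G k b)) : ℝ) -
      ρ * #(G.interedges (colorClass G k a) (colorClass G k b))| ≤ #K' * d := by
  let f (x : V) : ℝ :=
    if color G k x = a then #{y ∈ G.neighborFinset x | y ∈ colorClass G k b} else 0
  have hf (x y : V) (hxy : color G (k + 1) x = color G (k + 1) y) : f x = f y := by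
    simp only [f, color_eq_color_of_succ hxy, card_filter, mem_colorClass]
    rw [sum_neighborFinset_eq_of_color_eq hxy fun z _ w _ h => by rw [h]]
  have hfd (x : V) : |f x| ≤ d := by
    simp only [f]
    split_ifs
    · rw [Nat.abs_cast]
      exact_mod_cast (card_filter_le _ _).trans (hG x)
    · simp
  have hsum (S : Finset V) :
      (#(G.interedges (colorClass G k a ∩ S) (colorClass G k b)) : ℝ) = ∑ x ∈ S, f x := by
    rw [card_interedges_eq_sum, Nat.cast_sum, ← sum_filter]
    congr 1
    ext x
    simp [mem_colorClass, and_comm]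
  have hsum_univ := hsum univ
  rw [inter_univ] at hsum_univ
  rw [hsum, hsum_univ]
  exact hU.abs_sum_sub_le hK' (Nat.cast_nonneg d) hf hfd

theorem abs_card_interedges_sub_card_interedges_le (hG : ∀ v, G.degree v ≤ d)
    (hU : Proportional (color G (k + 1)) ρ U) (hK' : ∀ x, color G (k + 1) x ∈ K') (a b : ℕ) :
    |(#(G.interedges (colorClass G k a ∩ U) (colorClass G k b \ U)) : ℝ) -
      #(G.interedges (colorClass G k b ∩ U) (colorClass G k a \ U))| ≤ 2 * (#K' * d) := by
  have hsplit (a b : ℕ) : (#(G.interedges (colorClass G k a ∩ U) (colorClass G k b ∩ U)) : ℝ) +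
      #(G.interedges (colorClass G k a ∩ U) (colorClass G k b \ U)) =
      #(G.interedges (colorClass G k a ∩ U) (colorClass G k b)) :=
    mod_cast card_interedges_inter_add_sdiff G _ _ U
  have hab := abs_le.1 (abs_card_interedges_sub_le hG hU hK' a b)
  have hba := abs_le.1 (abs_card_interedges_sub_le hG hU hK' b a)
  rw [← hsplit] at hab hba
  rw [card_interedges_comm G (colorClass G k b),
    card_interedges_comm G (colorClass G k b ∩ U)] at hba
  exact abs_le.2 ⟨by linarith, by linarith⟩

theorem IsReduced.card_interedges_le_of_mem (hred : IsReduced G L k U)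
    (hG : ∀ v, G.degree v ≤ d) {a b : ℕ} {e : V × V}
    (he : e ∈ G.interedges (colorClass G k a ∩ U) (colorClass G k b \ U)) :
    #(G.interedges (colorClass G k b ∩ U) (colorClass G k a \ U)) ≤ ((d + 1) ^ (L + 3)) ^ 2 := by
  have hsub : G.interedges (colorClass G k b ∩ U) (colorClass G k a \ U) ⊆
      closedBall G (L + 3) e.1 ×ˢ closedBall G (L + 3) e.1 := by
    intro e' he'
    simp only [SimpleGraph.mem_interedges_iff, mem_inter, mem_sdiff, mem_colorClass] at he he'
    have hball := hred e (by simp [SimpleGraph.mem_interedges_iff, he]) e'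
      (by simp [SimpleGraph.mem_interedges_iff, he']) (he.1.1.trans he'.2.1.1.symm)
      (he.2.1.1.trans he'.1.1.symm)
    rw [mem_closedBall] at hball
    rw [mem_product, mem_closedBall, mem_closedBall]
    have hle : ((L + 2 : ℕ) : ℕ∞) ≤ (L + 3 : ℕ) := Nat.cast_le.2 (Nat.le_succ _)
    refine ⟨hball.trans hle, (SimpleGraph.edist_triangle (v := e'.1)).trans ?_⟩
    rw [SimpleGraph.edist_eq_one_iff_adj.2 he'.2.2]
    exact_mod_cast add_le_add_left hball 1
  refine (card_le_card hsub).trans ?_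
  rw [card_product, ← sq]
  exact Nat.pow_le_pow_left (card_closedBall_le hG _ _) 2

theorem IsReduced.card_interedges_colorClass_le (hred : IsReduced G L k U)
    (hG : ∀ v, G.degree v ≤ d) (hU : Proportional (color G (k + 1)) ρ U)
    (hK' : ∀ x, color G (k + 1) x ∈ K') (a b : ℕ) :
    (#(G.interedges (colorClass G k a ∩ U) (colorClass G k b \ U)) : ℝ) ≤
      ((d + 1) ^ (L + 3)) ^ 2 + 2 * (#K' * d) := by
  obtain hempty | ⟨e, he⟩ :=
    (G.interedges (colorClass G k b ∩ U) (colorClass G k a \ U)).eq_empty_or_nonempty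
  · have := (abs_le.1 (abs_card_interedges_sub_card_interedges_le hG hU hK' a b)).2
    rw [hempty, card_empty, Nat.cast_zero, sub_zero] at this
    exact this.trans (le_add_of_nonneg_left (by positivity))
  · refine le_add_of_le_of_nonneg ?_ (by positivity)
    exact_mod_cast hred.card_interedges_le_of_mem hG he

theorem IsReduced.cutSize_le (hred : IsReduced G L k U) (hG : ∀ v, G.degree v ≤ d)
    (hU : Proportional (color G (k + 1)) ρ U) (hK : ∀ x, color G k x ∈ K)
    (hK' : ∀ x, color G (k + 1) x ∈ K') :
    (cutSize G U : ℝ) ≤ #K ^ 2 * (((d + 1) ^ (L + 3)) ^ 2 + 2 * (#K' * d)) := by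
  have hsub : G.interedges U Uᶜ ⊆ (K ×ˢ K).biUnion fun ab =>
      G.interedges (colorClass G k ab.1 ∩ U) (colorClass G k ab.2 \ U) := by
    intro e he
    rw [SimpleGraph.mem_interedges_iff, mem_compl] at he
    refine mem_biUnion.2 ⟨(color G k e.1, color G k e.2), mem_product.2 ⟨hK _, hK _⟩, ?_⟩
    simp [SimpleGraph.mem_interedges_iff, mem_colorClass, he]
  calc
    (cutSize G U : ℝ) ≤ ∑ ab ∈ K ×ˢ K,
        (#(G.interedges (colorClass G k ab.1 ∩ U) (colorClass G k ab.2 \ U)) : ℝ) :=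
      mod_cast (card_le_card hsub).trans card_biUnion_le
    _ ≤ #(K ×ˢ K) • (((d + 1) ^ (L + 3)) ^ 2 + 2 * (#K' * d)) :=
      sum_le_card_nsmul _ _ _ fun ab _ => hred.card_interedges_colorClass_le hG hU hK' ab.1 ab.2
    _ = _ := by
      rw [card_product, nsmul_eq_mul, Nat.cast_mul, ← sq]

end Cut

/-! ### Disjoint unions -/

section ComponentEmbedding

open SimpleGraph

variable {V W : Type*} {F : SimpleGraph W} {G : SimpleGraph V} {φ : F ↪g G} {d : ℕ} {p : ℝ[X]}

/-- An embedding of graphs is a component embedding if its range is a union of connected components: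
the rest of the graph does not affect the Laplacian there. -/
def IsComponentEmbedding (φ : F ↪g G) : Prop := ∀ a y, G.Adj (φ a) y → y ∈ Set.range φ

theorem isComponentEmbedding_sumInl :
    IsComponentEmbedding (Embedding.sumInl : F ↪g F ⊕g G) := by
  rintro a (y | y) h
  · exact ⟨y, rfl⟩
  · exact absurd h (not_adj_sum_inl_inr a y)

theorem isComponentEmbedding_sumInr :
    IsComponentEmbedding (Embedding.sumInr : G ↪g F ⊕g G) := by
  rintro a (y | y) h
  · exact absurd h.symm (not_adj_sum_inl_inr y a)
  · exact ⟨y, rfl⟩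

theorem isComponentEmbedding_boxProdRight (v : V) :
    IsComponentEmbedding ((⊥ : SimpleGraph V).boxProdRight F v) := by
  rintro a ⟨u, y⟩ h
  obtain ⟨-, rfl⟩ : F.Adj a y ∧ v = u := by simpa [boxProd_adj] using h
  exact ⟨y, rfl⟩

theorem isComponentEmbedding_iso (e : F ≃g G) : IsComponentEmbedding e.toRelEmbedding :=
  fun _ y _ => e.surjective y

theorem IsComponentEmbedding.neighborFinset_eq (hφ : IsComponentEmbedding φ) (a : W)
    {_ : Fintype (F.neighborSet a)} {_ : Fintype (G.neighborSet (φ a))} :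
    G.neighborFinset (φ a) = (F.neighborFinset a).map φ.toEmbedding := by
  ext y
  simp only [mem_neighborFinset, mem_map]
  constructor
  · intro h
    obtain ⟨b, rfl⟩ := hφ a y h
    exact ⟨b, φ.map_adj_iff.1 h, rfl⟩
  · rintro ⟨b, h, rfl⟩
    exact φ.map_adj_iff.2 h

theorem IsComponentEmbedding.degree_eq (hφ : IsComponentEmbedding φ) (a : W)
    {_ : Fintype (F.neighborSet a)} {_ : Fintype (G.neighborSet (φ a))} :
    G.degree (φ a) = F.degree a := by
  rw [← card_neighborFinset_eq_degree, hφ.neighborFinset_eq, card_map,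
    card_neighborFinset_eq_degree]

variable [Fintype W]

theorem degree_bot_boxProd_le (hF : ∀ w, F.degree w ≤ d) (x : V × W)
    {_ : Fintype (((⊥ : SimpleGraph V) □ F).neighborSet x)} :
    ((⊥ : SimpleGraph V) □ F).degree x ≤ d :=
  ((isComponentEmbedding_boxProdRight x.1).degree_eq x.2).trans_le (hF x.2)

variable [Fintype V]

theorem degree_sum_le (hF : ∀ w, F.degree w ≤ d) (hG : ∀ v, G.degree v ≤ d) (x : W ⊕ V)
    {_ : Fintype ((F ⊕g G).neighborSet x)} : (F ⊕g G).degree x ≤ d := by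
  rcases x with w | v
  · exact (isComponentEmbedding_sumInl.degree_eq w).trans_le (hF w)
  · exact (isComponentEmbedding_sumInr.degree_eq v).trans_le (hG v)

theorem degree_comap_le (hG : ∀ v, G.degree v ≤ d) (f : W ↪ V) (w : W) :
    (G.comap f).degree w ≤ d :=
  ((Embedding.comap f G).toCopy.degree_le w).trans (hG _)

variable [DecidableEq V] [DecidableEq W]

theorem IsComponentEmbedding.normalizedLaplacian_apply (hφ : IsComponentEmbedding φ) (a b : W) :
    normalizedLaplacian G (φ a) (φ b) = normalizedLaplacian F a b := by
  simp only [normalizedLaplacian, φ.injective.eq_iff, φ.map_adj_iff, hφ.degree_eq]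

theorem IsComponentEmbedding.normalizedLaplacian_pow_apply (hφ : IsComponentEmbedding φ) (m : ℕ)
    (a b : W) : (normalizedLaplacian G ^ m) (φ a) (φ b) = (normalizedLaplacian F ^ m) a b := by
  induction m generalizing a with
  | zero => simp only [pow_zero, Matrix.one_apply, φ.injective.eq_iff]
  | succ m ih =>
    simp only [normalizedLaplacian_pow_succ_apply, hφ.neighborFinset_eq, sum_map,
      RelEmbedding.coe_toEmbedding, hφ.normalizedLaplacian_apply, ih]

theorem IsComponentEmbedding.localEval_eq (hφ : IsComponentEmbedding φ) (a : W) :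
    localEval p G (φ a) = localEval p F a := by
  simp only [localEval, aeval_eq_sum_range, Matrix.sum_apply, Matrix.smul_apply,
    hφ.normalizedLaplacian_pow_apply]

theorem polyTrace_sum : polyTrace p (F ⊕g G) = polyTrace p F + polyTrace p G := by
  rw [polyTrace, Fintype.sum_sum_type]
  exact congrArg₂ (· + ·) (sum_congr rfl fun w _ => isComponentEmbedding_sumInl.localEval_eq w)
    (sum_congr rfl fun v _ => isComponentEmbedding_sumInr.localEval_eq v)

theorem polyTrace_bot_boxProd :
    polyTrace p ((⊥ : SimpleGraph V) □ F) = Fintype.card V * polyTrace p F := by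
  have key (v : V) : ∑ w, localEval p ((⊥ : SimpleGraph V) □ F) (v, w) = polyTrace p F :=
    sum_congr rfl fun w _ => (isComponentEmbedding_boxProdRight v).localEval_eq w
  simp only [polyTrace, Fintype.sum_prod_type, key, sum_const, card_univ, nsmul_eq_mul]

theorem polyTrace_comap (e : W ≃ V) : polyTrace p (G.comap e) = polyTrace p G := by
  rw [polyTrace, polyTrace, ← e.sum_comp]
  exact sum_congr rfl fun w _ =>
    ((isComponentEmbedding_iso (Iso.comap e G)).localEval_eq w).symm

theorem abs_polyTrace_le (p : ℝ[X]) (hG : ∀ v, G.degree v ≤ d) :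
    |polyTrace p G| ≤ Fintype.card V * evalBound p d := by
  refine (abs_sum_le_sum_abs _ _).trans ((sum_le_card_nsmul _ _ _ fun v _ =>
    abs_localEval_le p hG v).trans_eq ?_)
  rw [card_univ, nsmul_eq_mul]

-- Disjoint copies of `F` cover all but fewer than `card W` of the vertices of `V`.
theorem exists_abs_polyTrace_sub_card_mul_le (V : Type*) [Fintype V] [DecidableEq V] [Nonempty W]
    (hF : ∀ w, F.degree w ≤ d) : ∃ Q : SimpleGraph V, (∀ v, Q.degree v ≤ d) ∧ ∀ p : ℝ[X],
      |polyTrace p Q - Fintype.card V * (polyTrace p F / Fintype.card W)| ≤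
        2 * (Fintype.card W * evalBound p d) := by
  set m := Fintype.card W with hm
  set q := Fintype.card V / m
  set r := Fintype.card V % m
  have hm0 : 0 < m := Fintype.card_pos
  have hdiv : q * m + r = Fintype.card V := Nat.div_add_mod' _ _
  let e : V ≃ Fin q × W ⊕ Fin r := Fintype.equivOfCardEq (by simp [← hm, hdiv])
  have hbot (i : Fin r) {_ : Fintype ((⊥ : SimpleGraph (Fin r)).neighborSet i)} :
      (⊥ : SimpleGraph (Fin r)).degree i ≤ d := by simp
  refine ⟨(((⊥ : SimpleGraph (Fin q)) □ F) ⊕g (⊥ : SimpleGraph (Fin r))).comap e,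
    degree_comap_le (degree_sum_le (degree_bot_boxProd_le hF ·) (hbot ·) ·) e.toEmbedding,
    fun p => ?_⟩
  rw [polyTrace_comap, polyTrace_sum, polyTrace_bot_boxProd, Fintype.card_fin]
  have hrm : (r : ℝ) ≤ m := by exact_mod_cast (Nat.mod_lt _ hm0).le
  have hrest : |polyTrace p (⊥ : SimpleGraph (Fin r))| ≤ m * evalBound p d :=
    (abs_polyTrace_le p (hbot ·)).trans (by
      rw [Fintype.card_fin]
      exact mul_le_mul_of_nonneg_right hrm (evalBound_nonneg p d))
  have hFp : r / (m : ℝ) * |polyTrace p F| ≤ m * evalBound p d :=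
    (mul_le_of_le_one_left (abs_nonneg _) (div_le_one_of_le₀ hrm (by positivity))).trans
      (abs_polyTrace_le p hF)
  have hsplit : q * polyTrace p F + polyTrace p (⊥ : SimpleGraph (Fin r)) -
      Fintype.card V * (polyTrace p F / m) =
        polyTrace p (⊥ : SimpleGraph (Fin r)) - r / m * polyTrace p F := by
    rw [← hdiv]
    have : (m : ℝ) ≠ 0 := by positivity
    push_cast
    field_simp
    ring
  rw [hsplit, two_mul]
  refine (abs_sub _ _).trans (add_le_add hrest ?_)
  rwa [abs_mul, abs_of_nonneg (by positivity)]

end ComponentEmbedding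

section Transplant

open SimpleGraph

variable {V : Type*} {G H : SimpleGraph V} {U : Finset V} {Q : SimpleGraph U} {d L j : ℕ}
  {p : ℝ[X]} {x : V}

/-- The graph obtained from `G` by removing all edges that meet `U` and placing `Q` on `U`. -/
def transplant (G : SimpleGraph V) (U : Finset V) (Q : SimpleGraph U) : SimpleGraph V :=
  (Q ⊕g G.comap (Subtype.val : {x // x ∉ U} → V)).comap (Equiv.sumCompl (· ∈ U)).symm

theorem transplant_adj_of_notMem {y : V} (hx : x ∉ U) (hy : y ∉ U) :
    (transplant G U Q).Adj x y ↔ G.Adj x y := by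
  simp [transplant, hx, hy]

variable [Fintype V]

theorem degree_transplant_le (hG : ∀ v, G.degree v ≤ d) (hQ : ∀ u, Q.degree u ≤ d) (v : V) :
    (transplant G U Q).degree v ≤ d :=
  degree_comap_le (degree_sum_le hQ (degree_comap_le hG (.subtype _)) ·)
    (Equiv.sumCompl (· ∈ U)).symm.toEmbedding v

theorem polyTrace_transplant [DecidableEq V] : polyTrace p (transplant G U Q) =
    polyTrace p Q + polyTrace p (G.comap (Subtype.val : {x // x ∉ U} → V)) :=
  (polyTrace_comap _).trans polyTrace_sum

theorem card_biUnion_incidenceFinset_le (hG : ∀ v, G.degree v ≤ d) (U : Finset V) :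
    #(U.biUnion fun x => G.incidenceFinset x) ≤ d * #U := by
  rw [mul_comm]
  exact card_biUnion_le_card_mul _ _ _ fun x _ =>
    (G.card_incidenceFinset_eq_degree x).trans_le (hG x)

theorem ncard_symmDiff_le_of_forall_notMem (hG : ∀ v, G.degree v ≤ d) (hH : ∀ v, H.degree v ≤ d)
    (h : ∀ x ∉ U, ∀ y ∉ U, (G.Adj x y ↔ H.Adj x y)) :
    (symmDiff G.edgeSet H.edgeSet).ncard ≤ 2 * (d * #U) := by
  have hsub : symmDiff G.edgeSet H.edgeSet ⊆ ((U.biUnion fun x => G.incidenceFinset x) ∪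
      U.biUnion fun x => H.incidenceFinset x : Finset (Sym2 V)) := by
    intro e he
    have hmeet : ∃ x ∈ U, x ∈ e := by
      by_contra! hU
      induction e with
      | _ x y =>
        have := h x (fun hx => hU x hx (Sym2.mem_mk_left x y)) y
          (fun hy => hU y hy (Sym2.mem_mk_right x y))
        simp [Set.mem_symmDiff, this] at he
    obtain ⟨x, hx, hxe⟩ := hmeet
    rw [mem_coe, mem_union, mem_biUnion, mem_biUnion]
    rcases he with ⟨he, -⟩ | ⟨he, -⟩
    · exact .inl ⟨x, hx, by simpa using ⟨he, hxe⟩⟩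
    · exact .inr ⟨x, hx, by simpa using ⟨he, hxe⟩⟩
  refine (Set.ncard_le_ncard hsub).trans ?_
  rw [Set.ncard_coe_finset, two_mul]
  exact (card_union_le _ _).trans (add_le_add (card_biUnion_incidenceFinset_le hG U)
    (card_biUnion_incidenceFinset_le hH U))

theorem cutSize_le (hG : ∀ v, G.degree v ≤ d) (U : Finset V) : cutSize G U ≤ d * #U := by
  rw [cutSize, card_interedges_eq_sum, mul_comm, ← smul_eq_mul]
  exact sum_le_card_nsmul _ _ _ fun x _ => (card_filter_le _ _).trans (hG x)

/-- The vertices outside `U` that have a neighbour in `U`. -/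
def outerBoundary (G : SimpleGraph V) (U : Finset V) : Finset V :=
  (G.interedges U Uᶜ).image Prod.snd

theorem card_outerBoundary_le : #(outerBoundary G U) ≤ cutSize G U := card_image_le

theorem mem_of_adj_of_notMem_outerBoundary {y : V} (hx : x ∉ U) (hxT : x ∉ outerBoundary G U)
    (h : G.Adj x y) : y ∉ U := fun hy =>
  hxT (mem_image.2 ⟨(y, x), (mem_interedges_iff G).2 ⟨hy, mem_compl.2 hx, h.symm⟩, rfl⟩)

variable [DecidableEq V]

theorem map_neighborFinset_comap_subtype (hx : x ∉ U) (hxT : x ∉ outerBoundary G U) :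
    ((G.comap (Subtype.val : {x // x ∉ U} → V)).neighborFinset ⟨x, hx⟩).map (.subtype _) =
      G.neighborFinset x := by
  ext y
  simp only [mem_map, mem_neighborFinset, comap_adj, Function.Embedding.subtype_apply,
    Subtype.exists, exists_and_left, exists_prop, exists_eq_right_right, and_iff_left_iff_imp]
  exact mem_of_adj_of_notMem_outerBoundary hx hxT

theorem color_comap_subtype_eq (hx : x ∉ U) (h : Disjoint (closedBall G j x) (outerBoundary G U)) :
    color (G.comap (Subtype.val : {x // x ∉ U} → V)) j ⟨x, hx⟩ = color G j x := by
  induction j generalizing x with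
  | zero => rfl
  | succ j ih =>
    have hxT : x ∉ outerBoundary G U :=
      disjoint_left.1 h (mem_closedBall.2 (by simp))
    rw [color_succ_eq_color_succ_iff, ← map_neighborFinset_comap_subtype hx hxT, map_val,
      Multiset.map_map]
    refine Multiset.map_congr rfl fun y hy => ih y.2 (h.mono_left fun z hz => ?_)
    have hxy : G.edist x y = 1 := edist_eq_one_iff_adj.2 (by simpa using hy)
    rw [mem_closedBall] at hz ⊢
    calc G.edist x z ≤ G.edist x y + G.edist y z := G.edist_triangle
      _ ≤ 1 + j := by rw [hxy]; gcongr
      _ = (j + 1 : ℕ) := by rw [add_comm, Nat.cast_succ]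

-- Only the vertices close to the outer boundary of `U` notice the removal of `U`.
theorem abs_polyTrace_comap_subtype_sub_le (hp : p.natDegree ≤ L)
    (hG : ∀ v, G.degree v ≤ d) (hL : (L : ℕ∞) < G.egirth) (U : Finset V) :
    |polyTrace p (G.comap (Subtype.val : {x // x ∉ U} → V)) -
      (polyTrace p G - ∑ x ∈ U, localEval p G x)| ≤
        cutSize G U * (d + 1) ^ (L + 1) * (2 * evalBound p d) := by
  set F := G.comap (Subtype.val : {x // x ∉ U} → V)
  set B := (outerBoundary G U).biUnion (closedBall G (L + 1))
  have hF : (L : ℕ∞) < F.egirth :=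
    hL.trans_le (Embedding.comap (.subtype _) G).toCopy.isContained.egirth_le
  have hzero (x : V) (hx : x ∉ U) (hxB : x ∉ B) : localEval p F ⟨x, hx⟩ - localEval p G x = 0 :=
    sub_eq_zero.2 <| localEval_eq_of_color_eq hp hF hL <| color_comap_subtype_eq hx <|
      disjoint_right.2 fun t ht htx => hxB <| mem_biUnion.2 ⟨t, ht, by
        rwa [mem_closedBall, edist_comm, ← mem_closedBall]⟩
  have hterm (x : V) (hx : x ∉ U) :
      |localEval p F ⟨x, hx⟩ - localEval p G x| ≤ if x ∈ B then 2 * evalBound p d else 0 := by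
    split_ifs with hxB
    · rw [two_mul]
      exact (abs_sub _ _).trans (add_le_add
        (abs_localEval_le p (degree_comap_le hG (.subtype _)) _) (abs_localEval_le p hG x))
    · rw [hzero x hx hxB, abs_zero]
  have hB : #B ≤ cutSize G U * (d + 1) ^ (L + 1) :=
    (card_biUnion_le_card_mul _ _ _ fun x _ => card_closedBall_le hG (L + 1) x).trans
      (Nat.mul_le_mul_right _ card_outerBoundary_le)
  have hE := evalBound_nonneg p d
  have hG' : polyTrace p G - ∑ x ∈ U, localEval p G x = ∑ x ∈ Uᶜ, localEval p G x :=
    sub_eq_of_eq_add' (sum_add_sum_compl U _).symm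
  rw [hG', sum_subtype Uᶜ fun _ : V => mem_compl, polyTrace, ← sum_sub_distrib]
  calc _ ≤ ∑ x : {x // x ∉ U}, |localEval p F x - localEval p G x| := abs_sum_le_sum_abs _ _
    _ ≤ ∑ x : {x // x ∉ U}, if x.1 ∈ B then 2 * evalBound p d else 0 :=
      sum_le_sum fun x _ => hterm x x.2
    _ = ∑ x ∈ Uᶜ, if x ∈ B then 2 * evalBound p d else 0 :=
      (sum_subtype Uᶜ (fun _ : V => mem_compl) fun x => if x ∈ B then 2 * evalBound p d else 0).symm
    _ ≤ ∑ x, if x ∈ B then 2 * evalBound p d else 0 :=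
      sum_le_univ_sum_of_nonneg fun x => by split_ifs <;> positivity
    _ = #B * (2 * evalBound p d) := by rw [← sum_filter, filter_univ_mem, sum_const, nsmul_eq_mul]
    _ ≤ _ := by gcongr; exact_mod_cast hB

end Transplant

/-! ### Editing the graph -/

section Editing

variable {V : Type*} [Fintype V] {G : SimpleGraph V} {U : Finset V} {Q : SimpleGraph U} {d L : ℕ}
  {K K' : Finset ℕ} {p : ℝ[X]} {ρ : ℝ}

/-- A bound for the effect of a transplant on a polynomial trace, relative to `evalBound`, when
the vertices have at most `K` colours at level `L` and at most `K'` at level `L + 1`. -/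
def transplantError (d L K K' : ℕ) : ℝ :=
  2 * (K ^ 2 * (((d + 1) ^ (L + 3)) ^ 2 + 2 * (K' * d)) * (d + 1) ^ (L + 1)) + K'

theorem Proportional.abs_card_sub_le {c : V → ℕ} (hU : Proportional c ρ U) (hK : ∀ x, c x ∈ K) :
    |(#U : ℝ) - ρ * Fintype.card V| ≤ #K := by
  simpa using hU.abs_sum_sub_le (f := fun _ => 1) hK zero_le_one (fun _ _ _ => rfl) (by simp)

theorem polyTrace_eq_of_color_eq [DecidableEq V] {H : SimpleGraph V} (hp : p.natDegree ≤ L)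
    (hG : (L : ℕ∞) < G.egirth) (hH : (L : ℕ∞) < H.egirth)
    (h : color G (L + 1) = color H (L + 1)) : polyTrace p G = polyTrace p H :=
  sum_congr rfl fun v _ => localEval_eq_of_color_eq hp hG hH (congrFun h v)

theorem IsReduced.abs_polyTrace_transplant_sub_le [DecidableEq V] (hred : IsReduced G L L U)
    (hU : Proportional (color G (L + 1)) ρ U) (hK : ∀ x, color G L x ∈ K)
    (hK' : ∀ x, color G (L + 1) x ∈ K') (hG : ∀ v, G.degree v ≤ d) (hg : (L : ℕ∞) < G.egirth)
    (hp : p.natDegree ≤ L) :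
    |polyTrace p (transplant G U Q) - ((1 - ρ) * polyTrace p G + polyTrace p Q)| ≤
      transplantError d L #K #K' * evalBound p d := by
  have hE := evalBound_nonneg p d
  have hinside : |∑ x ∈ U, localEval p G x - ρ * polyTrace p G| ≤ #K' * evalBound p d :=
    hU.abs_sum_sub_le hK' hE (fun _ _ => localEval_eq_of_color_eq hp hg hg)
      (abs_localEval_le p hG)
  have houtside := (abs_polyTrace_comap_subtype_sub_le hp hG hg U).trans
    (mul_le_mul_of_nonneg_right (mul_le_mul_of_nonneg_right (hred.cutSize_le hG hU hK hK')
      (by positivity)) (by positivity))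
  have hsplit : polyTrace p (transplant G U Q) - ((1 - ρ) * polyTrace p G + polyTrace p Q) =
      (polyTrace p (G.comap (Subtype.val : {x // x ∉ U} → V)) -
        (polyTrace p G - ∑ x ∈ U, localEval p G x)) -
      (∑ x ∈ U, localEval p G x - ρ * polyTrace p G) := by
    rw [polyTrace_transplant]
    ring
  rw [hsplit]
  refine (abs_sub _ _).trans ((add_le_add houtside hinside).trans_eq ?_)
  rw [transplantError]
  ring

theorem exists_transplant (d : ℕ) (hL : 1 ≤ L) (hρ : 0 ≤ ρ) (hρ1 : ρ ≤ 1) :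
    ∃ C : ℝ, 0 ≤ C ∧ ∀ (V : Type*) [Fintype V] [DecidableEq V] (G₀ : SimpleGraph V),
      (∀ v, G₀.degree v ≤ d) → (L : ℕ∞) < G₀.egirth →
      ∃ U : Finset V, |(#U : ℝ) - ρ * Fintype.card V| ≤ C ∧
        ∀ Q : SimpleGraph U, (∀ u, Q.degree u ≤ d) → ∃ G : SimpleGraph V,
          (∀ v, G.degree v ≤ d) ∧ (symmDiff G₀.edgeSet G.edgeSet).ncard ≤ 4 * (d * #U) ∧
          ∀ p : ℝ[X], p.natDegree ≤ L →
            |polyTrace p G - ((1 - ρ) * polyTrace p G₀ + polyTrace p Q)| ≤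
              C * evalBound p d := by
  obtain ⟨K, hK⟩ := exists_finset_forall_color_mem d L
  obtain ⟨K', hK'⟩ := exists_finset_forall_color_mem d (L + 1)
  have hC : (#K' : ℝ) ≤ transplantError d L #K #K' := le_add_of_nonneg_left (by positivity)
  refine ⟨transplantError d L #K #K', (Nat.cast_nonneg _).trans hC, fun V _ _ G₀ hG₀ hg₀ => ?_⟩
  obtain ⟨U, hU⟩ := exists_proportional (color G₀ (L + 1)) hρ hρ1
  obtain ⟨G, hcolor, hg, hdiff, hred⟩ := exists_isReduced G₀ U L hL hg₀
  have hcolor' := hcolor (L + 1) le_rfl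
  have hG (v : V) : G.degree v ≤ d :=
    (degree_eq_degree_of_color_eq (congrFun hcolor' v)).trans_le (hG₀ v)
  refine ⟨U, (hU.abs_card_sub_le (hK' V G₀ hG₀)).trans hC, fun Q hQ => ⟨transplant G U Q,
    degree_transplant_le hG hQ, ?_, fun p hp => ?_⟩⟩
  · have hcut := cutSize_le hG₀ U
    have htransplant : (symmDiff G.edgeSet (transplant G U Q).edgeSet).ncard ≤ 2 * (d * #U) :=
      ncard_symmDiff_le_of_forall_notMem hG (degree_transplant_le hG hQ)
        fun x hx y hy => (transplant_adj_of_notMem hx hy).symm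
    have htriangle := (Set.ncard_le_ncard (symmDiff_triangle G₀.edgeSet G.edgeSet
      (transplant G U Q).edgeSet)).trans (Set.ncard_union_le _ _)
    lia
  · rw [← polyTrace_eq_of_color_eq hp hg hg₀ hcolor']
    exact hred.abs_polyTrace_transplant_sub_le (hcolor' ▸ hU) (hK V G hG) (hK' V G hG) hG hg hp

end Editing

section Moments

variable {ι : Type*} {V : Type*} [Fintype V] [DecidableEq V] {d : ℕ}

/-- The normalized traces of the polynomials `p l` of the normalized Laplacian of `G`: these are
averages of local evaluations over the vertices, and moments of the spectral distribution. -/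
def moments (p : ι → ℝ[X]) (G : SimpleGraph V) (l : ι) : ℝ := polyTrace (p l) G / Fintype.card V

theorem abs_moments_le (p : ι → ℝ[X]) {G : SimpleGraph V} (hG : ∀ v, G.degree v ≤ d) (l : ι) :
    |moments p G l| ≤ evalBound (p l) d := by
  rw [moments, abs_div, Nat.abs_cast]
  exact div_le_of_le_mul₀ (Nat.cast_nonneg _) (evalBound_nonneg _ _)
    ((abs_polyTrace_le (p l) hG).trans_eq (mul_comm _ _))

theorem exists_finite_moments_approx [Finite ι] (d : ℕ) (p : ι → ℝ[X]) {η : ℝ} (hη : 0 < η) :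
    ∃ S : Set (Σ n : ℕ, SimpleGraph (Fin n)), S.Finite ∧
      (∀ F ∈ S, 0 < F.1 ∧ ∀ v, F.2.degree v ≤ d) ∧
      ∀ (n : ℕ) (H : SimpleGraph (Fin n)), 0 < n → (∀ v, H.degree v ≤ d) →
        ∃ F ∈ S, ∀ l, |moments p F.2 l - moments p H l| ≤ η := by
  have := Fintype.ofFinite ι
  let A : Set (Σ n : ℕ, SimpleGraph (Fin n)) := {F | 0 < F.1 ∧ ∀ v, F.2.degree v ≤ d}
  let m (F : Σ n : ℕ, SimpleGraph (Fin n)) : ι → ℝ := moments p F.2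
  have hbound : TotallyBounded (m '' A) := by
    refine (isCompact_closedBall (0 : ι → ℝ)
      (∑ l, evalBound (p l) d)).totallyBounded.subset ?_
    rintro _ ⟨F, ⟨-, hF⟩, rfl⟩
    have hnonneg (l : ι) : 0 ≤ evalBound (p l) d := evalBound_nonneg _ _
    rw [mem_closedBall_zero_iff, pi_norm_le_iff_of_nonneg (sum_nonneg fun l _ => hnonneg l)]
    exact fun l => (abs_moments_le p hF l).trans
      (single_le_sum (fun l _ => hnonneg l) (mem_univ l))
  obtain ⟨S, hSA, hS, hcover⟩ := Set.exists_subset_image_finite_and.1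
    (Metric.finite_approx_of_totallyBounded hbound η hη)
  refine ⟨S, hS, hSA, fun n H hn hH => ?_⟩
  obtain ⟨_, ⟨F, hF, rfl⟩, hclose⟩ := Set.mem_iUnion₂.1
    (hcover (Set.mem_image_of_mem _ (show ⟨n, H⟩ ∈ A from ⟨hn, hH⟩)))
  refine ⟨F, hF, fun l => ?_⟩
  rw [abs_sub_comm, ← Real.dist_eq]
  exact (dist_le_pi_dist (m ⟨n, H⟩) (m F) l).trans (Metric.mem_ball.1 hclose).le

-- The graph consists of copies of one of finitely many graphs.
theorem exists_polyTrace_close [Finite ι] (d : ℕ) (p : ι → ℝ[X]) {η : ℝ} (hη : 0 < η) :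
    ∃ C : ℝ, 0 ≤ C ∧ ∀ (n : ℕ) (H : SimpleGraph (Fin n)), 0 < n → (∀ v, H.degree v ≤ d) →
      ∀ (W : Type*) [Fintype W] [DecidableEq W], ∃ Q : SimpleGraph W, (∀ w, Q.degree w ≤ d) ∧
        ∀ l, |polyTrace (p l) Q - Fintype.card W * moments p H l| ≤ η * Fintype.card W + C := by
  have := Fintype.ofFinite ι
  obtain ⟨S, hS, hSd, happrox⟩ := exists_finite_moments_approx d p hη
  lift S to Finset (Σ n : ℕ, SimpleGraph (Fin n)) using hS
  have hnonneg (F : Σ n : ℕ, SimpleGraph (Fin n)) (l : ι) :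
      0 ≤ 2 * (F.1 * evalBound (p l) d) := by
    have := evalBound_nonneg (p l) d
    positivity
  refine ⟨∑ F ∈ S, ∑ l, 2 * (F.1 * evalBound (p l) d),
    sum_nonneg fun F _ => sum_nonneg fun l _ => hnonneg F l, fun n H hn hH W _ _ => ?_⟩
  obtain ⟨F, hF, hclose⟩ := happrox n H hn hH
  have : NeZero F.1 := ⟨(hSd F hF).1.ne'⟩
  obtain ⟨Q, hQ, hcopies⟩ := exists_abs_polyTrace_sub_card_mul_le W (hSd F hF).2
  refine ⟨Q, hQ, fun l => ?_⟩
  have hC : 2 * (F.1 * evalBound (p l) d) ≤ ∑ F ∈ S, ∑ l, 2 * (F.1 * evalBound (p l) d) :=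
    (single_le_sum (fun l _ => hnonneg F l) (mem_univ l)).trans (single_le_sum
      (f := fun F => ∑ l, 2 * (F.1 * evalBound (p l) d))
      (fun F _ => sum_nonneg fun l _ => hnonneg F l) hF)
  have hmoments : |Fintype.card W * moments p F.2 l - Fintype.card W * moments p H l| ≤
      η * Fintype.card W := by
    rw [← mul_sub, abs_mul, Nat.abs_cast, mul_comm]
    exact mul_le_mul_of_nonneg_right (hclose l) (Nat.cast_nonneg _)
  have := hcopies (p l)
  rw [Fintype.card_fin] at this
  rw [add_comm]
  refine (abs_sub_le _ (Fintype.card W * moments p F.2 l) _).trans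
    (add_le_add (le_trans ?_ hC) hmoments)
  simpa [moments] using this

end Moments

/-! ### Closeness to robustly spectral properties -/

section Closeness

variable {d : ℕ} {ρ η δ ε : ℝ}

-- Replace a proportion `ρ` of `G₀` by a graph whose moments are almost those of `H`.
theorem card_mul_moments {ι : Type*} {n : ℕ} (hn : 0 < n) (p : ι → ℝ[X])
    (G : SimpleGraph (Fin n)) (l : ι) : n * moments p G l = polyTrace (p l) G := by
  rw [moments, Fintype.card_fin, mul_div_cancel₀ _ (by positivity)]

theorem abs_sub_mul_le_of_mixture {t a b u n h x y z : ℝ} (hρ1 : ρ ≤ 1)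
    (hx : |t - ((1 - ρ) * a + b)| ≤ x) (hy : |b - u * h| ≤ y) (hz : |(u - ρ * n) * h| ≤ z) :
    |t - n * h| ≤ (1 - ρ) * |a - n * h| + x + y + z := by
  have hsplit : t - n * h = (t - ((1 - ρ) * a + b)) + (b - u * h) + (u - ρ * n) * h +
      (1 - ρ) * (a - n * h) := by ring
  rw [hsplit]
  refine (abs_add_le _ _).trans ?_
  rw [abs_mul (1 - ρ), abs_of_nonneg (sub_nonneg.2 hρ1)]
  linarith [abs_add_three (t - ((1 - ρ) * a + b)) (b - u * h) ((u - ρ * n) * h)]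

theorem exists_abs_polyTrace_sub_le {ι : Type*} [Finite ι] (d : ℕ) {L : ℕ} (hL : 1 ≤ L)
    {p : ι → ℝ[X]} (hp : ∀ l, (p l).natDegree ≤ L) (hρ : 0 ≤ ρ) (hρ1 : ρ ≤ 1) (hη : 0 < η) :
    ∃ C : ℝ, 0 ≤ C ∧ ∀ (n : ℕ) (G₀ H : SimpleGraph (Fin n)), 0 < n → (∀ v, G₀.degree v ≤ d) →
      (∀ v, H.degree v ≤ d) → (L : ℕ∞) < G₀.egirth → ∃ G : SimpleGraph (Fin n),
        (∀ v, G.degree v ≤ d) ∧ (symmDiff G₀.edgeSet G.edgeSet).ncard ≤ 4 * (d * (ρ * n + C)) ∧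
        ∀ l, |polyTrace (p l) G - polyTrace (p l) H| ≤
          (1 - ρ) * |polyTrace (p l) G₀ - polyTrace (p l) H| + η * ρ * n + C := by
  have := Fintype.ofFinite ι
  obtain ⟨C₁, hC₁, htransplant⟩ := exists_transplant d hL hρ hρ1
  obtain ⟨C₂, hC₂, hclose⟩ := exists_polyTrace_close d p hη
  set E := ∑ l, evalBound (p l) d
  have hE (l : ι) : evalBound (p l) d ≤ E :=
    single_le_sum (fun l _ => evalBound_nonneg (p l) d) (mem_univ l)
  have hE0 : 0 ≤ E := sum_nonneg fun l _ => evalBound_nonneg (p l) d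
  have hC : 0 ≤ 2 * C₁ * E + η * C₁ + C₂ := by positivity
  refine ⟨2 * C₁ * E + η * C₁ + C₂ + C₁, by positivity, fun n G₀ H hn hG₀ hH hg => ?_⟩
  obtain ⟨U, hU, hQG⟩ := htransplant (Fin n) G₀ hG₀ hg
  obtain ⟨Q, hQ, hQclose⟩ := hclose n H hn hH U
  obtain ⟨G, hG, hdiff, hGclose⟩ := hQG Q hQ
  rw [Fintype.card_fin] at hU
  have hUle : (#U : ℝ) ≤ ρ * n + C₁ := by linarith [(abs_le.1 hU).2]
  refine ⟨G, hG, ?_, fun l => ?_⟩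
  · calc ((symmDiff G₀.edgeSet G.edgeSet).ncard : ℝ) ≤ 4 * (d * #U) := by exact_mod_cast hdiff
      _ ≤ _ := by gcongr; linarith
  · have htransfer : |polyTrace (p l) G - ((1 - ρ) * polyTrace (p l) G₀ + polyTrace (p l) Q)| ≤
        C₁ * E := (hGclose (p l) (hp l)).trans (mul_le_mul_of_nonneg_left (hE l) hC₁)
    have hcopies : |polyTrace (p l) Q - #U * moments p H l| ≤ η * (ρ * n + C₁) + C₂ := by
      have := hQclose l
      rw [Fintype.card_coe] at this
      exact this.trans (by gcongr)
    have hcard : |(#U - ρ * n) * moments p H l| ≤ C₁ * E := by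
      rw [abs_mul]
      exact mul_le_mul hU ((abs_moments_le p hH l).trans (hE l)) (abs_nonneg _) hC₁
    rw [← card_mul_moments hn p H]
    linarith [abs_sub_mul_le_of_mixture hρ1 htransfer hcopies hcard]

theorem exists_sum_abs_polyTrace_sub_le {ι : Type*} [Fintype ι] (d : ℕ) {L : ℕ} (hL : 1 ≤ L)
    {p : ι → ℝ[X]} (hp : ∀ l, (p l).natDegree ≤ L) (hρ : 0 ≤ ρ) (hρ1 : ρ ≤ 1) (hη : 0 < η) :
    ∃ C : ℝ, ∀ (n : ℕ) (G₀ H : SimpleGraph (Fin n)), 0 < n → (∀ v, G₀.degree v ≤ d) →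
      (∀ v, H.degree v ≤ d) → (L : ℕ∞) < G₀.egirth → ∃ G : SimpleGraph (Fin n),
        (∀ v, G.degree v ≤ d) ∧ (symmDiff G₀.edgeSet G.edgeSet).ncard ≤ 4 * (d * (ρ * n + C)) ∧
        ∑ l, |polyTrace (p l) G - polyTrace (p l) H| ≤
          (1 - ρ) * (∑ l, |polyTrace (p l) G₀ - polyTrace (p l) H|) + η * ρ * n + C := by
  set m : ℝ := (Fintype.card ι : ℝ) with hm
  have : 0 ≤ m := Nat.cast_nonneg _
  obtain ⟨C, hC, hcorrect⟩ := exists_abs_polyTrace_sub_le d hL hp hρ hρ1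
    (η := η / (m + 1)) (by positivity)
  refine ⟨m * C + C, fun n G₀ H hn hG₀ hH hg => ?_⟩
  obtain ⟨G, hG, hdiff, hclose⟩ := hcorrect n G₀ H hn hG₀ hH hg
  refine ⟨G, hG, hdiff.trans ?_, (sum_le_sum fun l _ => hclose l).trans ?_⟩
  · gcongr
    exact le_add_of_nonneg_left (by positivity)
  · simp only [sum_add_distrib, ← mul_sum, sum_const, card_univ, nsmul_eq_mul, ← hm]
    have hη' : m * (η / (m + 1) * ρ * n) ≤ η * ρ * n := by
      have : m * (η / (m + 1)) ≤ η := by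
        rw [mul_div_assoc', div_le_iff₀ (by positivity)]
        nlinarith
      calc m * (η / (m + 1) * ρ * n) = m * (η / (m + 1)) * ρ * n := by ring
        _ ≤ _ := by gcongr
    linarith

theorem sum_abs_polyTrace_sub_eq {ι : Type*} [Fintype ι] {n : ℕ} (hn : 0 < n) (p : ι → ℝ[X])
    (G H : SimpleGraph (Fin n)) : ∑ l, |polyTrace (p l) G - polyTrace (p l) H| =
      n * ∑ l, |moments p G l - moments p H l| := by
  simp only [← card_mul_moments hn, ← mul_sub, abs_mul, Nat.abs_cast, mul_sum]

theorem sum_abs_polyTrace_sub_le {ι : Type*} [Fintype ι] {n : ℕ} (hn : 0 < n) (p : ι → ℝ[X])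
    (G H H' : SimpleGraph (Fin n)) : ∑ l, |polyTrace (p l) G - polyTrace (p l) H'| ≤
      n * ∑ l, |moments p G l - moments p H l| +
        ∑ l, |polyTrace (p l) H - polyTrace (p l) H'| := by
  rw [← sum_abs_polyTrace_sub_eq hn, ← sum_add_distrib]
  exact sum_le_sum fun l _ => abs_sub_le _ _ _

theorem exists_spectrum_correction (d : ℕ) (hδ : 0 < δ) (hε : 0 < ε) :
    ∃ (N : ℕ) (p : Fin N → ℝ[X]) (η : ℝ) (L n₀ : ℕ), 0 < η ∧ (∀ l, (p l).natDegree ≤ L) ∧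
      ∀ n ≥ n₀, 0 < n → ∀ G₀ H H' : SimpleGraph (Fin n), DegreeBounded d G₀ → DegreeBounded d H →
        DegreeBounded d H' → (L : ℕ∞) < G₀.egirth →
        ∑ i, |graphSpectrum H i - graphSpectrum H' i| ≤ δ * n →
        ∑ l, |moments p G₀ l - moments p H l| ≤ 2 * η →
        ∃ G : SimpleGraph (Fin n), DegreeBounded d G ∧
          (symmDiff G₀.edgeSet G.edgeSet).ncard ≤ ε * d * n ∧
          ∑ i, |graphSpectrum G i - graphSpectrum H' i| ≤ δ * n := by
  obtain ⟨ρ, hρ, hρ1, hρε⟩ : ∃ ρ : ℝ, 0 < ρ ∧ ρ ≤ 1 ∧ 8 * ρ ≤ ε :=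
    ⟨min 1 (ε / 8), by positivity, min_le_left _ _, by linarith [min_le_right 1 (ε / 8)]⟩
  have hγ : 0 < ρ * δ / 8 := by positivity
  obtain ⟨N, p, htests⟩ := exists_trace_tests d hγ
  set L := univ.sup (fun l => (p l).natDegree) + 1
  have hp (l : Fin N) : (p l).natDegree ≤ L :=
    (le_sup (f := fun l => (p l).natDegree) (mem_univ l)).trans (Nat.le_succ _)
  obtain ⟨C, hcorrect⟩ := exists_sum_abs_polyTrace_sub_le d (Nat.le_add_left 1 _) hp hρ.le hρ1
    (η := δ / 4) (by positivity)
  obtain ⟨n₀, hn₀⟩ := exists_nat_ge (max (8 * C / ε) (4 * C / (ρ * δ)))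
  rw [max_le_iff, div_le_iff₀' hε, div_le_iff₀' (by positivity)] at hn₀
  refine ⟨N, p, ρ * δ / 8, L, n₀, hγ, hp, fun n hn hn0 G₀ H H' hG₀ hH hH' hg hHH' hmom => ?_⟩
  obtain ⟨G, hG, hdiff, hGtrace⟩ := hcorrect n G₀ H' hn0 hG₀ hH' hg
  have hnn₀ : (n₀ : ℝ) ≤ n := Nat.cast_le.2 hn
  refine ⟨G, hG, hdiff.trans ?_, ?_⟩
  · have : 4 * (ρ * n + C) ≤ ε * n := by nlinarith
    nlinarith
  · have hG₀H' : ∑ l, |polyTrace (p l) G₀ - polyTrace (p l) H'| ≤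
        n * (2 * (ρ * δ / 8)) + (δ * n + ρ * δ / 8 * n) := by
      have hHtrace := (abs_le.1 (htests n H H' hH hH')).1
      refine (sum_abs_polyTrace_sub_le hn0 p G₀ H H').trans ?_
      gcongr
      linarith
    have hspectrum := (abs_le.1 (htests n G H' hG hH')).2
    have hcontract := mul_le_mul_of_nonneg_left hG₀H' (sub_nonneg.2 hρ1)
    have : 0 ≤ ρ * (ρ * δ) * n := by positivity
    nlinarith [hn₀.2, mul_le_mul_of_nonneg_left hnn₀ (by positivity : 0 ≤ ρ * δ)]

theorem RobustlySpectral.exists_not_isFar {P : GraphClass}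
    (hP : RobustlySpectral d allGraphs δ P) (hδ : 0 < δ) (hε : 0 < ε) :
    ∃ (N : ℕ) (p : Fin N → ℝ[X]) (η : ℝ) (L n₀ : ℕ), 0 < η ∧ (∀ l, (p l).natDegree ≤ L) ∧
      ∀ n ≥ n₀, 0 < n → ∀ G H : SimpleGraph (Fin n), DegreeBounded d G → (L : ℕ∞) < G.egirth →
        H ∈ P.graphs n → ∑ l, |moments p G l - moments p H l| ≤ 2 * η → ¬ IsFar d ε P G := by
  obtain ⟨N, p, η, L, n₀, hη, hp, hcorrect⟩ := exists_spectrum_correction d hδ hε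
  refine ⟨N, p, η, L, n₀, hη, hp, fun n hn hn0 G H hG hg hHP hGH hfar => ?_⟩
  obtain ⟨S, hS, hmem⟩ := hP n
  obtain ⟨-, hH, x, hx, hHx⟩ := (hmem H).1 hHP
  obtain ⟨H', -, hH', rfl⟩ := hS hx
  obtain ⟨F, hF, hdiff, hFx⟩ := hcorrect n hn hn0 G H H' hG hH hH' hg hHx hGH
  exact (hfar F hF ((hmem F).2 ⟨trivial, hF, _, hx, hFx⟩)).not_ge hdiff

end Closeness

/-! ### Query algorithms -/

section Queries

variable {n d q q' : ℕ} {α β : Type*}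

/-- The function `f` of the oracle can be computed with at most `q` adaptive queries. This is stated
in continuation-passing style: any algorithm that starts from the value of `f` can be preceded by
the computation of `f`. -/
def IsQueryable (q : ℕ) (f : Oracle n d → α) : Prop :=
  ∀ cont : α → QueryTree n d, ∃ T : QueryTree n d, ∀ O,
    T.run O = (cont (f O)).run O ∧ T.numQueries O ≤ q + (cont (f O)).numQueries O

theorem isQueryable_const (a : α) : IsQueryable q fun _ : Oracle n d => a :=
  fun cont => ⟨cont a, fun _ => ⟨rfl, Nat.le_add_left _ _⟩⟩

theorem isQueryable_apply (v : Fin n) (i : Fin d) : IsQueryable 1 fun O => O v i :=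
  fun cont => ⟨.query v i cont, fun _ => ⟨rfl, (Nat.add_comm _ _).le⟩⟩

theorem IsQueryable.bind {f : Oracle n d → α} {g : α → Oracle n d → β} (hf : IsQueryable q f)
    (hg : ∀ a, IsQueryable q' (g a)) : IsQueryable (q + q') fun O => g (f O) O := fun cont => by
  choose S hS using fun a => hg a cont
  obtain ⟨T, hT⟩ := hf S
  refine ⟨T, fun O => ⟨(hT O).1.trans (hS _ O).1, (hT O).2.trans ?_⟩⟩
  rw [Nat.add_assoc]
  exact Nat.add_le_add_left (hS _ O).2 q

theorem IsQueryable.map {f : Oracle n d → α} (hf : IsQueryable q f) (g : α → β) :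
    IsQueryable q fun O => g (f O) :=
  fun cont => hf (cont ∘ g)

theorem IsQueryable.pi {s : ℕ} {f : Fin s → Oracle n d → α} (hf : ∀ i, IsQueryable q (f i)) :
    IsQueryable (s * q) fun O i => f i O := by
  induction s with
  | zero =>
    convert isQueryable_const (Fin.elim0 : Fin 0 → α) using 2
  | succ s ih =>
    have hcons := (hf 0).bind fun a =>
      (ih fun i => hf i.succ).map (Fin.cons a : _ → Fin (s + 1) → α)
    convert hcons using 2 with O
    · ring
    · exact (Fin.cons_self_tail _).symm

theorem IsQueryable.exists_queryTree {f : Oracle n d → Bool} (hf : IsQueryable q f) :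
    ∃ T : QueryTree n d, ∀ O, T.run O = f O ∧ T.numQueries O ≤ q :=
  hf .answer

theorem Oracle.Represents.coe_filterMap_eq {O : Oracle n d} {G : SimpleGraph (Fin n)}
    (h : O.Represents G) (hG : DegreeBounded d G) (v : Fin n) :
    ((List.finRange d).filterMap (O v) : Multiset (Fin n)) = (G.neighborFinset v).val := by
  have hnodup : ((List.finRange d).filterMap (O v)).Nodup :=
    (List.nodup_finRange d).filterMap fun i j w hi hj => h.inj v i j w hi hj
  have hsub : (⟨_, Multiset.coe_nodup.2 hnodup⟩ : Finset (Fin n)) ⊆ G.neighborFinset v :=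
    fun w hw => by
      obtain ⟨i, -, hi⟩ := List.mem_filterMap.1 (Multiset.mem_coe.1 (mem_mk.1 hw))
      exact (G.mem_neighborFinset _ _).2 (h.adj v i w hi)
  refine congrArg Finset.val (eq_of_subset_of_card_le hsub ?_)
  have hlength := calc
    ((List.finRange d).filterMap (O v)).length
    _ = #{i : Fin d | (O v i).isSome} := by
      simp [List.length_filterMap_eq_countP, List.countP_eq_length_filter, card_def, univ,
        Fintype.elems]
    _ = #{i : Fin d | (i : ℕ) < G.degree v} := by simp only [h.isSome_iff]
    _ = G.degree v := by rw [Fin.card_filter_val_lt, min_eq_right (hG v)]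
  exact (G.card_neighborFinset_eq_degree v).trans hlength.symm |>.le

theorem Oracle.Represents.unique {O : Oracle n d} {G H : SimpleGraph (Fin n)}
    (hOG : O.Represents G) (hOH : O.Represents H) (hG : DegreeBounded d G)
    (hH : DegreeBounded d H) : G = H := by
  ext v w
  rw [← SimpleGraph.mem_neighborFinset, ← mem_val, ← hOG.coe_filterMap_eq hG,
    hOH.coe_filterMap_eq hH, mem_val, SimpleGraph.mem_neighborFinset]

theorem exists_isQueryable_color (d j : ℕ) : ∃ q : ℕ, ∀ (n : ℕ) (v : Fin n),
    ∃ c : Oracle n d → ℕ, IsQueryable q c ∧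
      ∀ O (G : SimpleGraph (Fin n)), O.Represents G → DegreeBounded d G → c O = color G j v := by
  induction j with
  | zero => exact ⟨0, fun n v => ⟨fun _ => 0, isQueryable_const 0, fun _ _ _ _ => rfl⟩⟩
  | succ j ih =>
    obtain ⟨q, ih⟩ := ih
    refine ⟨d * (1 + q), fun n v => ?_⟩
    choose c hc hcolor using ih n
    have hstep (i : Fin d) : IsQueryable (1 + q) fun O => (O v i).map fun w => c w O :=
      (isQueryable_apply v i).bind (g := fun x O => x.map fun w => c w O) fun
        | none => isQueryable_const none
        | some w => (hc w).map some
    refine ⟨_, (IsQueryable.pi hstep).map fun t =>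
      Encodable.encode ((List.finRange d).filterMap t : Multiset ℕ), fun O G hO hG => ?_⟩
    rw [color, ← hO.coe_filterMap_eq hG, Multiset.map_coe, List.map_filterMap]
    simp only [hcolor _ O G hO hG]

theorem exists_isQueryable_localEval (d : ℕ) {ι : Type*} {p : ι → ℝ[X]} {L : ℕ}
    (hp : ∀ l, (p l).natDegree ≤ L) : ∃ q : ℕ, ∀ (n : ℕ) (v : Fin n),
    ∃ g : Oracle n d → ι → ℝ, IsQueryable q g ∧ ∀ O (G : SimpleGraph (Fin n)), O.Represents G →
      DegreeBounded d G → (L : ℕ∞) < G.egirth → g O = fun l => localEval (p l) G v := by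
  obtain ⟨q, hq⟩ := exists_isQueryable_color d (L + 1)
  let RootedGraph := {x : Σ n, SimpleGraph (Fin n) × Fin n // (L : ℕ∞) < x.2.1.egirth}
  let value (x : RootedGraph) (l : ι) : ℝ := localEval (p l) x.1.2.1 x.1.2.2
  have hfactor : value.FactorsThrough fun x => color x.1.2.1 (L + 1) x.1.2.2 := fun x y hxy =>
    funext fun l => localEval_eq_of_color_eq (hp l) x.2 y.2 hxy
  obtain ⟨φ, hφ⟩ := (Function.factorsThrough_iff _).1 hfactor
  refine ⟨q, fun n v => ?_⟩
  obtain ⟨c, hc, hcolor⟩ := hq n v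
  refine ⟨_, hc.map φ, fun O G hO hG hL => ?_⟩
  rw [hcolor O G hO hG]
  exact (congrFun hφ ⟨⟨n, G, v⟩, hL⟩).symm

end Queries

/-! ### Random sampling -/

section Sampling

variable {X ι Ω : Type*} [Fintype X] [Fintype ι] [Fintype Ω] {s : ℕ}

theorem expect_fin_succ_pi (φ : (Fin (s + 1) → X) → ℝ) :
    𝔼 ω, φ ω = 𝔼 ω : Fin s → X, 𝔼 x, φ (Fin.cons x ω) := by
  rw [expect_comm, ← expect_product', univ_product_univ]
  exact (Fintype.expect_equiv (Fin.consEquiv fun _ => X) _ _ fun _ => rfl).symm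

theorem expect_add_const_sq [Nonempty X] {g : X → ℝ} (hg : 𝔼 x, g x = 0) (c : ℝ) :
    𝔼 x, (g x + c) ^ 2 = 𝔼 x, g x ^ 2 + c ^ 2 := by
  simp only [add_sq, expect_add_distrib, mul_assoc, ← mul_expect, ← expect_mul, hg, zero_mul,
    mul_zero, add_zero, Fintype.expect_const]

theorem expect_sq_sum_pi [Nonempty X] {g : X → ℝ} (hg : 𝔼 x, g x = 0) (s : ℕ) :
    𝔼 ω : Fin s → X, (∑ i, g (ω i)) ^ 2 = s * 𝔼 x, g x ^ 2 := by
  induction s with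
  | zero => simp
  | succ s ih =>
    simp only [expect_fin_succ_pi, Fin.sum_univ_succ, Fin.cons_zero, Fin.cons_succ,
      expect_add_const_sq hg, expect_add_distrib, ih, Fintype.expect_const]
    push_cast
    ring

theorem expect_sq_expect_sub_expect_le [Nonempty X] {f : X → ℝ} {b : ℝ} (hf : ∀ x, |f x| ≤ b)
    (hs : s ≠ 0) : 𝔼 ω : Fin s → X, (𝔼 i, f (ω i) - 𝔼 x, f x) ^ 2 ≤ b ^ 2 / s := by
  have hs' : (s : ℝ) ≠ 0 := by exact_mod_cast hs
  set μ := 𝔼 x, f x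
  have hmean : 𝔼 x, (f x - μ) = 0 := by rw [expect_sub_distrib, Fintype.expect_const, sub_self]
  have hvar : 𝔼 x, (f x - μ) ^ 2 ≤ b ^ 2 := by
    have hshift := expect_add_const_sq hmean μ
    simp only [sub_add_cancel] at hshift
    have hsq : 𝔼 x, f x ^ 2 ≤ b ^ 2 :=
      expect_le univ_nonempty fun x _ => sq_le_sq.2 ((hf x).trans (le_abs_self b))
    linarith [sq_nonneg μ]
  have hdev (ω : Fin s → X) : (𝔼 i, f (ω i) - μ) ^ 2 = (∑ i, (f (ω i) - μ)) ^ 2 / s ^ 2 := by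
    rw [← div_pow, Fintype.expect_eq_sum_div_card, sum_sub_distrib, sum_const, card_univ,
      Fintype.card_fin, nsmul_eq_mul, sub_div, mul_div_cancel_left₀ _ hs']
  calc 𝔼 ω : Fin s → X, (𝔼 i, f (ω i) - μ) ^ 2
      = s * (𝔼 x, (f x - μ) ^ 2) / s ^ 2 := by
        simp only [hdev, ← expect_div, expect_sq_sum_pi hmean]
    _ = (𝔼 x, (f x - μ) ^ 2) / s := by field_simp
    _ ≤ b ^ 2 / s := by gcongr

theorem two_mul_card_le_three_mul_card_filter_le [Nonempty Ω] {f : Ω → ℝ} (hf : ∀ ω, 0 ≤ f ω)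
    {t : ℝ} (ht : 3 * 𝔼 ω, f ω < t) : 2 * Fintype.card Ω ≤ 3 * #{ω | f ω ≤ t} := by
  have hsplit := card_filter_add_card_filter_not (s := (univ : Finset Ω)) fun ω => f ω ≤ t
  have ht0 : 0 < t := (mul_nonneg zero_le_three (expect_nonneg fun ω _ => hf ω)).trans_lt ht
  have hbad : (#{ω | ¬ f ω ≤ t} : ℝ) * t ≤ Fintype.card Ω * 𝔼 ω, f ω := by
    rw [Fintype.card_mul_expect, ← nsmul_eq_mul]
    exact (card_nsmul_le_sum _ _ _ fun ω hω => (not_le.1 (mem_filter.1 hω).2).le).trans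
      (sum_le_sum_of_subset_of_nonneg (subset_univ _) fun ω _ _ => hf ω)
  have hcard : 3 * (#{ω | ¬ f ω ≤ t} : ℝ) ≤ Fintype.card Ω := by
    refine le_of_mul_le_mul_right ?_ ht0
    calc 3 * (#{ω | ¬ f ω ≤ t} : ℝ) * t ≤ Fintype.card Ω * (3 * 𝔼 ω, f ω) := by linarith
      _ ≤ Fintype.card Ω * t := by gcongr
  have hcard' : 3 * #{ω | ¬ f ω ≤ t} ≤ Fintype.card Ω := by exact_mod_cast hcard
  rw [card_univ] at hsplit
  lia

theorem expect_sq_sum_abs_expect_sub_le [Nonempty X] {F : X → ι → ℝ} {B : ι → ℝ}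
    (hF : ∀ x l, |F x l| ≤ B l) (hs : s ≠ 0) :
    𝔼 ω : Fin s → X, (∑ l, |𝔼 i, F (ω i) l - 𝔼 x, F x l|) ^ 2 ≤
      Fintype.card ι * (∑ l, B l ^ 2) / s := by
  have hcauchy (a : ι → ℝ) : (∑ l, |a l|) ^ 2 ≤ Fintype.card ι * ∑ l, a l ^ 2 := by
    simpa only [sq_abs, card_univ] using
      sq_sum_le_card_mul_sum_sq (s := univ) (f := fun l => |a l|)
  calc _ ≤ 𝔼 ω : Fin s → X, Fintype.card ι * ∑ l, (𝔼 i, F (ω i) l - 𝔼 x, F x l) ^ 2 :=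
        expect_le_expect fun ω _ => hcauchy _
    _ = Fintype.card ι * ∑ l, 𝔼 ω : Fin s → X, (𝔼 i, F (ω i) l - 𝔼 x, F x l) ^ 2 := by
        rw [← mul_expect, expect_sum_comm]
    _ ≤ Fintype.card ι * ∑ l, B l ^ 2 / s := by
        refine mul_le_mul_of_nonneg_left (sum_le_sum fun l _ => ?_) (Nat.cast_nonneg _)
        exact expect_sq_expect_sub_expect_le (f := (F · l)) (hF · l) hs
    _ = Fintype.card ι * (∑ l, B l ^ 2) / s := by rw [← sum_div, mul_div_assoc]

theorem two_mul_card_le_three_mul_card_filter_expect [Nonempty X] {F : X → ι → ℝ} {B : ι → ℝ}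
    (hF : ∀ x l, |F x l| ≤ B l) {η : ℝ} (hη : 0 < η)
    (hs : 3 * (Fintype.card ι * ∑ l, B l ^ 2) < s * η ^ 2) :
    2 * Fintype.card (Fin s → X) ≤
      3 * #{ω : Fin s → X | ∑ l, |𝔼 i, F (ω i) l - 𝔼 x, F x l| ≤ η} := by
  have hs0 : s ≠ 0 := by
    rintro rfl
    rw [Nat.cast_zero, zero_mul] at hs
    exact hs.not_ge (by positivity)
  have hs' : (0 : ℝ) < s := by exact_mod_cast Nat.pos_of_ne_zero hs0
  have hmean : 3 * 𝔼 ω : Fin s → X, (∑ l, |𝔼 i, F (ω i) l - 𝔼 x, F x l|) ^ 2 < η ^ 2 := by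
    refine (mul_le_mul_of_nonneg_left (expect_sq_sum_abs_expect_sub_le hF hs0)
      zero_le_three).trans_lt ?_
    rwa [← mul_div_assoc, div_lt_iff₀ hs', mul_comm (η ^ 2)]
  refine (two_mul_card_le_three_mul_card_filter_le (fun ω => sq_nonneg _) hmean).trans ?_
  refine Nat.mul_le_mul_left 3 (card_le_card (monotone_filter_right _ fun ω _ hω => ?_))
  exact (pow_le_pow_iff_left₀ (sum_nonneg fun _ _ => abs_nonneg _) hη.le two_ne_zero).1 hω

end Sampling

/-! ### Testers -/

section Testers

variable {n d q q' s : ℕ} {𝔊 P : GraphClass} {ε : ℝ} {A : RandomizedAlgorithm n d}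

/-- `A` is a tester for `P` with parameter `ε` on the `n`-vertex graphs in `𝔊`, and makes at most
`q` queries. This is the condition imposed on each algorithm in `TestableOn`. -/
def IsTester (𝔊 P : GraphClass) (ε : ℝ) (q : ℕ) (A : RandomizedAlgorithm n d) : Prop :=
  (∀ T ∈ A.support, ∀ O : Oracle n d, T.numQueries O ≤ q) ∧
    ∀ G ∈ 𝔊.graphs n, DegreeBounded d G → ∀ O : Oracle n d, O.Represents G →
      (G ∈ P.graphs n → 2 / 3 ≤ A.prob O true) ∧ (IsFar d ε P G → 2 / 3 ≤ A.prob O false)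

theorem IsTester.mono (h : IsTester 𝔊 P ε q A) (hq : q ≤ q') : IsTester 𝔊 P ε q' A :=
  ⟨fun T hT O => (h.1 T hT O).trans hq, h.2⟩

theorem testableOn_of_forall_exists_isTester (h : ∀ ε > 0, ∃ q, ∀ n,
    ∃ A : RandomizedAlgorithm n d, IsTester 𝔊 P ε q A) : TestableOn d 𝔊 P := by
  choose! q hq using h
  exact ⟨q, hq⟩

theorem two_thirds_le_prob_map_uniformOfFintype {Ω : Type} [Fintype Ω] [Nonempty Ω]
    {T : Ω → QueryTree n d} {O : Oracle n d} {b : Bool} {S : Finset Ω}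
    (hS : 2 * Fintype.card Ω ≤ 3 * #S) (hT : ∀ ω ∈ S, (T ω).run O = b) :
    2 / 3 ≤ RandomizedAlgorithm.prob ((PMF.uniformOfFintype Ω).map T) O b := by
  have hsub : (S : Set Ω) ⊆ (QueryTree.run O ∘ T) ⁻¹' {b} := hT
  rw [RandomizedAlgorithm.prob, PMF.map_comp, ← PMF.toOuterMeasure_apply_singleton,
    PMF.toOuterMeasure_map_apply]
  refine le_trans ?_ (MeasureTheory.measure_mono hsub)
  rw [PMF.toOuterMeasure_uniformOfFintype_apply,
    ENNReal.le_div_iff_mul_le (.inl (by simp)) (.inl (ENNReal.natCast_ne_top _)),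
    mul_comm, ← mul_div_assoc, ENNReal.div_le_iff_le_mul (by simp) (by simp),
    mul_comm, mul_comm (_ : ENNReal) 3]
  simp only [coe_sort_coe, Fintype.card_coe]
  exact_mod_cast hS

theorem exists_isTester_of_isQueryable {Ω : Type} [Fintype Ω] [Nonempty Ω]
    {f : Ω → Oracle n d → Bool} (hf : ∀ ω, IsQueryable q (f ω))
    (h : ∀ G ∈ 𝔊.graphs n, DegreeBounded d G → ∀ O : Oracle n d, O.Represents G →
      ∃ S : Finset Ω, 2 * Fintype.card Ω ≤ 3 * #S ∧
        ∀ ω ∈ S, (G ∈ P.graphs n → f ω O = true) ∧ (IsFar d ε P G → f ω O = false)) :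
    ∃ A : RandomizedAlgorithm n d, IsTester 𝔊 P ε q A := by
  choose T hT using fun ω => (hf ω).exists_queryTree
  refine ⟨(PMF.uniformOfFintype Ω).map T, fun t ht O => ?_, fun G hG hGd O hO => ?_⟩
  · obtain ⟨ω, -, rfl⟩ := (PMF.mem_support_map_iff _ _ _).1 ht
    exact (hT ω O).2
  · obtain ⟨S, hS, hfS⟩ := h G hG hGd O hO
    exact ⟨fun hGP => two_thirds_le_prob_map_uniformOfFintype hS fun ω hω =>
        (hT ω O).1.trans ((hfS ω hω).1 hGP),
      fun hfar => two_thirds_le_prob_map_uniformOfFintype hS fun ω hω =>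
        (hT ω O).1.trans ((hfS ω hω).2 hfar)⟩

theorem IsFar.notMem {G : SimpleGraph (Fin n)} (h : IsFar d ε P G) (hε : 0 ≤ ε)
    (hG : DegreeBounded d G) : G ∉ P.graphs n := fun hGP => by
  have hlt := h G hG hGP
  rw [symmDiff_self, Set.bot_eq_empty, Set.ncard_empty, Nat.cast_zero] at hlt
  exact hlt.not_ge (by positivity)

theorem exists_isTester_mul (𝔊 P : GraphClass) (n d : ℕ) (hε : 0 ≤ ε) :
    ∃ A : RandomizedAlgorithm n d, IsTester 𝔊 P ε (n * d) A := by
  have hread : IsQueryable (n * (d * 1)) fun O : Oracle n d => O :=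
    .pi fun v => .pi fun i => isQueryable_apply v i
  rw [mul_one] at hread
  refine exists_isTester_of_isQueryable (Ω := Unit) (fun _ => hread.map fun O =>
    decide (∃ H ∈ P.graphs n, DegreeBounded d H ∧ O.Represents H)) fun G _ hGd O hO =>
    ⟨univ, by simp, fun _ _ => ⟨fun hGP => decide_eq_true ⟨G, hGP, hGd, hO⟩,
      fun hfar => decide_eq_false ?_⟩⟩
  rintro ⟨H, hHP, hHd, hH⟩
  exact hfar.notMem hε hGd (hO.unique hH hGd hHd ▸ hHP)

theorem exists_isTester_of_isQueryable_expect [Nonempty (Fin n)] {ι : Type*} [Fintype ι]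
    {F : SimpleGraph (Fin n) → Fin n → ι → ℝ} {g : Fin n → Oracle n d → ι → ℝ}
    {B : ι → ℝ} {η : ℝ} (hg : ∀ v, IsQueryable q (g v))
    (hgF : ∀ G ∈ 𝔊.graphs n, DegreeBounded d G → ∀ O : Oracle n d, O.Represents G →
      ∀ v, g v O = F G v)
    (hF : ∀ G : SimpleGraph (Fin n), DegreeBounded d G → ∀ v l, |F G v l| ≤ B l) (hη : 0 < η)
    (hs : 3 * (Fintype.card ι * ∑ l, B l ^ 2) < s * η ^ 2)
    (hfar : ∀ G ∈ 𝔊.graphs n, ∀ H ∈ P.graphs n, DegreeBounded d G →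
      ∑ l, |𝔼 v, F G v l - 𝔼 v, F H v l| ≤ 2 * η → ¬ IsFar d ε P G) :
    ∃ A : RandomizedAlgorithm n d, IsTester 𝔊 P ε (s * q) A := by
  refine exists_isTester_of_isQueryable (Ω := Fin s → Fin n) (fun ω =>
    (IsQueryable.pi fun i => hg (ω i)).map fun t : Fin s → ι → ℝ =>
      decide (∃ H ∈ P.graphs n, ∑ l, |𝔼 i, t i l - 𝔼 v, F H v l| ≤ η))
    fun G hG hGd O hO =>
      ⟨_, two_mul_card_le_three_mul_card_filter_expect (hF G hGd) hη hs, fun ω hω => ?_⟩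
  have hclose := (mem_filter.1 hω).2
  simp only [hgF G hG hGd O hO]
  refine ⟨fun hGP => decide_eq_true ⟨G, hGP, hclose⟩, fun hGfar => decide_eq_false ?_⟩
  rintro ⟨H, hHP, hH⟩
  refine hfar G hG H hHP hGd ?_ hGfar
  calc ∑ l, |𝔼 v, F G v l - 𝔼 v, F H v l|
      ≤ ∑ l, (|𝔼 i, F G (ω i) l - 𝔼 v, F G v l| + |𝔼 i, F G (ω i) l - 𝔼 v, F H v l|) :=
        sum_le_sum fun l _ => by
          rw [abs_sub_comm (𝔼 i, F G (ω i) l)]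
          exact abs_sub_le _ _ _
    _ ≤ 2 * η := by rw [sum_add_distrib, two_mul]; exact add_le_add hclose hH

theorem moments_apply_eq_expect {V ι : Type*} [Fintype V] [DecidableEq V] (p : ι → ℝ[X])
    (G : SimpleGraph V) (l : ι) : moments p G l = 𝔼 v, localEval (p l) G v :=
  (Fintype.expect_eq_sum_div_card _).symm

theorem exists_isTester_of_moments (d : ℕ) {ι : Type*} [Fintype ι] {p : ι → ℝ[X]} {L : ℕ}
    (hp : ∀ l, (p l).natDegree ≤ L) {η : ℝ} (hη : 0 < η) :
    ∃ q : ℕ, ∀ n > 0, (∀ G ∈ 𝔊.graphs n, (L : ℕ∞) < G.egirth) →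
      (∀ G ∈ 𝔊.graphs n, ∀ H ∈ P.graphs n, DegreeBounded d G →
        ∑ l, |moments p G l - moments p H l| ≤ 2 * η → ¬ IsFar d ε P G) →
      ∃ A : RandomizedAlgorithm n d, IsTester 𝔊 P ε q A := by
  obtain ⟨q, hq⟩ := exists_isQueryable_localEval d hp
  obtain ⟨s, hs⟩ := exists_nat_gt (3 * (Fintype.card ι * ∑ l, evalBound (p l) d ^ 2) / η ^ 2)
  rw [div_lt_iff₀ (by positivity)] at hs
  refine ⟨s * q, fun n hn hgirth hfar => ?_⟩
  have : Nonempty (Fin n) := ⟨⟨0, hn⟩⟩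
  choose g hg hlocal using hq n
  simp only [moments_apply_eq_expect] at hfar
  exact exists_isTester_of_isQueryable_expect hg
    (fun G hG hGd O hO v => hlocal v O G hO hGd (hgirth G hG))
    (fun G hGd v l => abs_localEval_le (p l) hGd v) hη hs hfar

end Testers

theorem GraphClass.HighGirth.exists_forall_lt_egirth {𝔊 : GraphClass} (h : 𝔊.HighGirth) (L : ℕ) :
    ∃ n₀, ∀ n ≥ n₀, ∀ G ∈ 𝔊.graphs n, (L : ℕ∞) < G.egirth := by
  obtain ⟨f, hf, hgirth⟩ := h
  obtain ⟨n₀, hn₀⟩ := Filter.eventually_atTop.1 (hf.eventually_gt_atTop L)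
  exact ⟨n₀, fun n hn G hG => (Nat.cast_lt.2 (hn₀ n hn)).trans_le (hgirth n G hG)⟩

end SpectralTesting

end

theorem theorem4 (d : ℕ) (𝔊 : SpectralTesting.GraphClass) (h𝔊 : 𝔊.HighGirth)
    (δ : ℝ) (hδ : 0 < δ) (P : SpectralTesting.GraphClass)
    (hP : SpectralTesting.RobustlySpectral d SpectralTesting.allGraphs δ P) :
    SpectralTesting.TestableOn d 𝔊 P := by
  refine SpectralTesting.testableOn_of_forall_exists_isTester fun ε hε => ?_
  obtain ⟨N, p, η, L, n₀, hη, hp, hfar⟩ := hP.exists_not_isFar hδ hε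
  obtain ⟨n₁, hgirth⟩ := h𝔊.exists_forall_lt_egirth L
  obtain ⟨q, hq⟩ := SpectralTesting.exists_isTester_of_moments (𝔊 := 𝔊) (P := P) (ε := ε) d hp hη
  refine ⟨max ((n₀ + n₁ + 1) * d) q, fun n => ?_⟩
  rcases le_total n (n₀ + n₁ + 1) with hn | hn
  · obtain ⟨A, hA⟩ := SpectralTesting.exists_isTester_mul 𝔊 P n d hε.le
    exact ⟨A, hA.mono ((Nat.mul_le_mul_right d hn).trans (le_max_left _ _))⟩
  · have hlarge := hgirth n (by lia)
    obtain ⟨A, hA⟩ := hq n (by lia) hlarge fun G hG H hH hGd =>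
      hfar n (by lia) (by lia) G H hGd (hlarge G hG) hH
    exact ⟨A, hA.mono (le_max_right _ _)⟩
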